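/- Let $\ell_2$ be the complex Hilbert space of square-summable sequences, $\mathcal B(\ell_2)$ its algebra of bounded operators, $\mathcal K(\ell_2)$ the ideal of compact operators, and $\pi:\mathcal B(\ell_2)\to\mathcal Q(\ell_2)=\mathcal B(\ell_2)/\mathcal K(\ell_2)$ the quotient map onto the Calkin algebra. A masa is a maximal abelian self-adjoint subalgebra. Fix an orthonormal basis $(e_k)_{k\in\mathbb N}$ of $\ell_2$, where $\mathbb N=\{0,1,2,\dots\}$. **The algebras.** For $X\subseteq\mathbb N$ let $P_X$ be the orthogonal projection onto the closed span of $\{e_{2k},e_{2k+1}:k\in X\}$. Let $\mathcal A_0$ be the set of all $T\in\mathcal B(\ell_2)$ such that $\langle Te_k,e_m\rangle\neq0$ implies $\{k,m\}\subseteq\{2n,2n+1\}$ for some $n$, and let $\mathcal A_0(X)$ be the set of all $T\in\mathcal A_0$ with $Te_{2n}=Te_{2n+1}=0$ for all $n\notin X$. For $\alpha\in(71/72,1]$ put $f_{\alpha,2n}=\alpha e_{2n}+\sqrt{1-\alpha^2}\,e_{2n+1}$ and $f_{\alpha,2n+1}=\sqrt{1-\alpha^2}\,e_{2n}-\alpha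 e_{2n+1}$. Let $\mathcal D(X,\alpha)$ be the set of all $T\in\mathcal A_0(X)$ such that $f_{\alpha,2n}$ and $f_{\alpha,2n+1}$ are eigenvectors of $T$ for every $n\in X$, and let $\mathcal D_{\mathcal K}(X,\alpha)$ be the set of all $T\in\mathcal A_0(X)$ of the form $T=S+R$ with $S\in\mathcal D(X,\alpha)$ and $R\in\mathcal K(\ell_2)\cap\mathcal A_0(X)$. For a family $\mathcal X$ of subsets of $\mathbb N$ and $\mathfrak A=(\alpha_X)_{X\in\mathcal X}\in(71/72,1]^{\mathcal X}$ let $$\mathcal M_{\mathcal X,\mathfrak A}=\{T\in\mathcal A_0:\ P_XTP_X\in\mathcal D_{\mathcal K}(X,\alpha_X)\text{ for all }X\in\mathcal X\}.$$ **The families.** Let $h_0$ be the Boolean monomorphism from the algebra of clopen subsets of $\{0,1\}^{\mathbb N}$ to $\wp(\mathbb N)$ that sends $\{x:x(k)=1\}$ to the set of all elements of $\mathbb N$ divisible by the $k$-th prime, for every $k\in\mathbb N$ (primes enumerated from index $0$), and let $[x|n]$ be the clopen set of all $y$ that agree with $x$ at all coordinates $i<n$. For $x\in\{0,1\}^{\mathbb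 N}$ let $\mathcal X_x$ be the family of all infinite $X\subseteq\mathbb N$ such that $X\setminus h_0([x|n])$ is finite for every $n$. For each $x$ fix an infinite almost disjoint family $\mathcal Y_x\subseteq\mathcal X_x$ that is maximal among the almost disjoint subfamilies of $\mathcal X_x$ (almost disjoint: distinct members have finite intersection). For $a\subseteq\{0,1\}^{\mathbb N}$ put $$\mathcal X_a=\bigcup_{x\in a}\mathcal X_x\ \cup\bigcup_{x\in\{0,1\}^{\mathbb N}\setminus a}\mathcal Y_x$$ and fix $\mathfrak A_a:\mathcal X_a\to(71/72,1]$ such that $$\{\mathfrak A_a^{-1}[\{r\}]:r\in(71/72,1]\}=\{\mathcal X_x:x\in a\}\cup\Big\{\{X\}:X\in\bigcup_{x\in\{0,1\}^{\mathbb N}\setminus a}\mathcal Y_x\Big\}.$$ **Proposition.** For every orthonormal basis $(e_k)$ and all choices of the families $\mathcal Y_x$ and the systems $\mathfrak A_a$ as above, $\pi[\mathcal M_{\mathcal X_a,\mathfrak A_a}]$ is a masa of $\mathcal Q(\ell_2)$ for every $a\subseteq\{0,1\}^{\mathbb N}$, and among these masas there are $2^{\mathfrak c}$ pairwise non-$*$-isomorphic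 ones: there is a set $\mathcal S$ of subsets of $\{0,1\}^{\mathbb N}$, of cardinality $2^{\mathfrak c}$, such that for any two distinct $a,b\in\mathcal S$ the algebras $\pi[\mathcal M_{\mathcal X_a,\mathfrak A_a}]$ and $\pi[\mathcal M_{\mathcal X_b,\mathfrak A_b}]$ are not $*$-isomorphic. -/

import Mathlib

namespace CalkinMasa

noncomputable section

/-! ### The Hilbert space, compact operators, and the Calkin algebra -/

/-- The complex Hilbert space of square-summable sequences. -/
abbrev L2 : Type := lp (fun _ : ℕ => ℂ) 2

/-- Bounded operators; the star operation is the Hilbert space adjoint. -/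
abbrev BL2 : Type := L2 →L[ℂ] L2

theorem op_mul_apply (S T : BL2) (x : L2) : (S * T) x = S (T x) := rfl

theorem inner_star_left (T : BL2) (x y : L2) :
    inner ℂ ((star T : BL2) x) y = inner ℂ x (T y) := by
  rw [ContinuousLinearMap.star_eq_adjoint, ContinuousLinearMap.adjoint_inner_left]

theorem inner_star_right (T : BL2) (x y : L2) :
    inner ℂ x ((star T : BL2) y) = inner ℂ (T x) y := by
  rw [ContinuousLinearMap.star_eq_adjoint, ContinuousLinearMap.adjoint_inner_right]

theorem isCompactOperator_star {T : BL2} (hT : IsCompactOperator T) :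
    IsCompactOperator (star T : BL2) := by
  have hTT : IsCompactOperator (T * star T : BL2) := hT.comp_clm (star T : BL2)
  rw [← ContinuousLinearMap.coe_coe, isCompactOperator_iff_isCompact_closure_image_closedBall
    (𝕜₁ := ℂ) _ one_pos]
  rw [← ContinuousLinearMap.coe_coe, isCompactOperator_iff_isCompact_closure_image_closedBall
    (𝕜₁ := ℂ) _ one_pos] at hTT
  have htb := hTT.totallyBounded.subset subset_closure
  refine TotallyBounded.isCompact_of_isClosed (TotallyBounded.closure ?_) isClosed_closure
  rw [Metric.totallyBounded_iff]
  intro ε hε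
  have hδ : 0 < ε ^ 2 / 4 := by positivity
  obtain ⟨t, ht, htf, hcov⟩ := Metric.finite_approx_of_totallyBounded htb _ hδ
  obtain ⟨s, hs, rfl⟩ := (Set.subset_image_iff).1 ht
  obtain ⟨u, hus, hu⟩ := Set.exists_subset_bijOn s (T * star T : BL2)
  have huf : u.Finite := hu.finite_iff_finite.2 htf
  refine ⟨(star T : BL2) '' u, huf.image _, ?_⟩
  rintro _ ⟨x, hx, rfl⟩
  have hxc := hcov ⟨x, hx, rfl⟩
  simp only [Set.mem_iUnion] at hxc
  obtain ⟨_, hy, hxy⟩ := hxc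
  replace hy : _ ∈ (T * star T : BL2) '' s := hy
  rw [← Set.BijOn.image_eq hu] at hy
  obtain ⟨y, hy, rfl⟩ := hy
  simp only [Set.mem_iUnion]
  refine ⟨_, ⟨y, hy, rfl⟩, ?_⟩
  have hy1 := hs (hus hy)
  rw [mem_closedBall_zero_iff] at hx hy1
  rw [Metric.mem_ball, dist_eq_norm, ContinuousLinearMap.coe_coe, ← map_sub] at hxy
  rw [Metric.mem_ball, dist_eq_norm, ContinuousLinearMap.coe_coe, ← map_sub]
  have h2 : ‖x - y‖ ≤ 2 := (norm_sub_le _ _).trans (by linarith)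
  have key : ‖(star T : BL2) (x - y)‖ ^ 2 ≤ 2 * ‖(T * star T : BL2) (x - y)‖ := by
    have h := inner_star_left T (x - y) ((star T : BL2) (x - y))
    rw [inner_self_eq_norm_sq_to_K] at h
    have h' : ‖(star T : BL2) (x - y)‖ ^ 2
        = ‖inner ℂ (x - y) (T ((star T : BL2) (x - y)))‖ := by
      rw [← h]; simp
    rw [h']
    exact (norm_inner_le_norm _ _).trans (mul_le_mul_of_nonneg_right h2 (norm_nonneg _))
  have : ‖(star T : BL2) (x - y)‖ ^ 2 < ε ^ 2 := by nlinarith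
  exact lt_of_pow_lt_pow_left₀ 2 hε.le this

/-- The two-sided ideal of compact operators. -/
def compactIdeal : Ideal BL2 where
  carrier := {T | IsCompactOperator T}
  add_mem' hS hT := IsCompactOperator.add hS hT
  zero_mem' := isCompactOperator_zero
  smul_mem' S _ hT := IsCompactOperator.clm_comp hT S

instance : compactIdeal.IsTwoSided where
  mul_mem_of_left S hT := IsCompactOperator.comp_clm hT S

theorem mem_compactIdeal {T : BL2} : T ∈ compactIdeal ↔ IsCompactOperator T := Iff.rfl

/-- The Calkin algebra: bounded operators modulo compact operators, with its quotient
`*`-algebra structure. -/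
abbrev Calkin : Type := BL2 ⧸ compactIdeal

instance : StarRing Calkin where
  star := Quotient.map' star fun S T h => by
    rw [Submodule.quotientRel_def] at h ⊢
    rw [← star_sub]
    exact isCompactOperator_star h
  star_involutive x := by
    obtain ⟨T, rfl⟩ := Ideal.Quotient.mk_surjective x
    exact congrArg (Ideal.Quotient.mk compactIdeal) (star_star T)
  star_mul x y := by
    obtain ⟨S, rfl⟩ := Ideal.Quotient.mk_surjective x
    obtain ⟨T, rfl⟩ := Ideal.Quotient.mk_surjective y
    exact congrArg (Ideal.Quotient.mk compactIdeal) (star_mul S T)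
  star_add x y := by
    obtain ⟨S, rfl⟩ := Ideal.Quotient.mk_surjective x
    obtain ⟨T, rfl⟩ := Ideal.Quotient.mk_surjective y
    exact congrArg (Ideal.Quotient.mk compactIdeal) (star_add S T)

/-- The quotient map from bounded operators onto the Calkin algebra. -/
def calkinMap : BL2 →⋆ₐ[ℂ] Calkin :=
  { Ideal.Quotient.mkₐ ℂ compactIdeal with
    map_star' := fun _ => rfl }

instance : StarModule ℂ Calkin where
  star_smul c x := by
    obtain ⟨T, rfl⟩ := Ideal.Quotient.mk_surjective x
    exact congrArg (Ideal.Quotient.mk compactIdeal) (star_smul c T)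

/-- A masa: a maximal abelian self-adjoint subalgebra. -/
def IsMasa {B : Type*} [Ring B] [StarRing B] [Algebra ℂ B] [StarModule ℂ B]
    (A : StarSubalgebra ℂ B) : Prop :=
  Maximal (fun C : StarSubalgebra ℂ B => ∀ x ∈ C, ∀ y ∈ C, x * y = y * x) A

/-! ### Block diagonal operators

Throughout, `e` is an orthonormal basis, and the `n`-th block is spanned by
`e (2 * n)` and `e (2 * n + 1)`. -/

section Blocks

variable (e : HilbertBasis ℕ ℂ L2)

/-- The orthogonal projection onto the closed span of the blocks with index in `A`. -/
def blockProj (A : Set ℕ) : BL2 :=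
  (Submodule.span ℂ (⋃ k ∈ A, {e (2 * k), e (2 * k + 1)})).topologicalClosure.starProjection

/-- The operators whose matrix is block diagonal with two by two blocks. -/
def blockSet : Set BL2 :=
  {T | ∀ k m : ℕ, inner ℂ (e m) (T (e k)) ≠ 0 →
    ∃ n : ℕ, ({k, m} : Set ℕ) ⊆ {2 * n, 2 * n + 1}}

/-- The block diagonal operators whose blocks outside `X` vanish. -/
def blockSetOn (X : Set ℕ) : Set BL2 :=
  {T | T ∈ blockSet e ∧ ∀ n ∉ X, T (e (2 * n)) = 0 ∧ T (e (2 * n + 1)) = 0}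

/-- The interval of parameters. -/
abbrev Param : Type := Set.Ioc (71 / 72 : ℝ) 1

/-- The first vector of the rotated basis of the `n`-th block. -/
def rotEven (α : Param) (n : ℕ) : L2 :=
  ((α : ℝ) : ℂ) • e (2 * n) + ((√(1 - (α : ℝ) ^ 2) : ℝ) : ℂ) • e (2 * n + 1)

/-- The second vector of the rotated basis of the `n`-th block. -/
def rotOdd (α : Param) (n : ℕ) : L2 :=
  ((√(1 - (α : ℝ) ^ 2) : ℝ) : ℂ) • e (2 * n) - ((α : ℝ) : ℂ) • e (2 * n + 1)

/-- The block diagonal operators supported on `X` all of whose blocks with index in `X` are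
diagonal with respect to the rotated basis with parameter `α`. -/
def rotDiag (X : Set ℕ) (α : Param) : Set BL2 :=
  {T | T ∈ blockSetOn e X ∧ ∀ n ∈ X,
    (∃ c : ℂ, T (rotEven e α n) = c • rotEven e α n) ∧
    (∃ d : ℂ, T (rotOdd e α n) = d • rotOdd e α n)}

/-- Compact perturbations, within the block diagonal operators supported on `X`, of the
elements of `rotDiag e X α`. -/
def rotDiagCompact (X : Set ℕ) (α : Param) : Set BL2 :=
  {T | T ∈ blockSetOn e X ∧ ∃ S ∈ rotDiag e X α, ∃ R ∈ blockSetOn e X,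
    IsCompactOperator R ∧ T = S + R}

/-- The underlying set of the algebra attached to a family `𝒳` of sets and a system `𝔄` of
parameters indexed by that family. -/
def masaSet {𝒳 : Set (Set ℕ)} (𝔄 : 𝒳 → Param) : Set BL2 :=
  {T | T ∈ blockSet e ∧
    ∀ X : 𝒳, blockProj e X * T * blockProj e X ∈ rotDiagCompact e X (𝔄 X)}

variable {e}

theorem exists_block_iff (k m : ℕ) :
    (∃ n : ℕ, ({k, m} : Set ℕ) ⊆ {2 * n, 2 * n + 1}) ↔ k / 2 = m / 2 := by
  constructor
  · rintro ⟨n, h⟩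
    have h1 := h (Set.mem_insert k {m})
    have h2 := h (Set.mem_insert_of_mem k rfl)
    simp only [Set.mem_insert_iff, Set.mem_singleton_iff] at h1 h2
    omega
  · intro h
    refine ⟨k / 2, ?_⟩
    rintro x (rfl | rfl) <;> simp only [Set.mem_insert_iff, Set.mem_singleton_iff] <;> omega

theorem inner_basis (m k : ℕ) : inner ℂ (e m) (e k) = if m = k then (1 : ℂ) else 0 :=
  orthonormal_iff_ite.1 e.orthonormal m k

theorem eq_of_inner_basis {x y : L2} (h : ∀ m, inner ℂ (e m) x = inner ℂ (e m) y) : x = y := by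
  apply e.repr.injective
  ext m
  rw [e.repr_apply_apply, e.repr_apply_apply, h]

theorem op_ext {S T : BL2} (h : ∀ k, S (e k) = T (e k)) : S = T := by
  refine ContinuousLinearMap.ext_on (s := Set.range e) ?_ ?_
  · have := e.dense_span
    rwa [← Submodule.dense_iff_topologicalClosure_eq_top] at this
  · rintro _ ⟨k, rfl⟩
    exact h k

open Classical in
theorem blockProj_basis (X : Set ℕ) (k : ℕ) :
    blockProj e X (e k) = if k / 2 ∈ X then e k else 0 := by
  unfold blockProj
  split_ifs with h
  · rw [Submodule.starProjection_eq_self_iff]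
    refine Submodule.le_topologicalClosure _ (Submodule.subset_span ?_)
    simp only [Set.mem_iUnion]
    refine ⟨k / 2, h, ?_⟩
    rcases Nat.even_or_odd' k with ⟨n, rfl | rfl⟩
    · left; congr 1; omega
    · right; simp only [Set.mem_singleton_iff]; congr 1; omega
  · rw [Submodule.starProjection_apply_eq_zero_iff, Submodule.orthogonal_closure,
      Submodule.mem_orthogonal]
    intro u hu
    induction hu using Submodule.span_induction with
    | mem x hx =>
      simp only [Set.mem_iUnion] at hx
      obtain ⟨n, hn, rfl | rfl⟩ := hx
      · rw [inner_basis, if_neg]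
        rintro rfl; apply h; convert hn using 1; omega
      · rw [inner_basis, if_neg]
        rintro rfl; apply h; convert hn using 1; omega
    | zero => simp
    | add x y _ _ hx hy => rw [inner_add_left, hx, hy, add_zero]
    | smul a x _ hx => rw [inner_smul_left, hx, mul_zero]

theorem star_blockProj (X : Set ℕ) : star (blockProj e X) = blockProj e X :=
  isSelfAdjoint_starProjection _

theorem blockProj_mul_self (X : Set ℕ) : blockProj e X * blockProj e X = blockProj e X :=
  Submodule.isIdempotentElem_starProjection _

theorem mem_blockSet_iff {T : BL2} :
    T ∈ blockSet e ↔ ∀ X, blockProj e X * T = T * blockProj e X := by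
  classical
  have hP : ∀ (X : Set ℕ) (m : ℕ) (x : L2),
      inner ℂ (e m) (blockProj e X x) = if m / 2 ∈ X then inner ℂ (e m) x else 0 := by
    intro X m x
    rw [← star_blockProj, inner_star_right, blockProj_basis]
    split_ifs <;> simp
  constructor
  · intro h X
    refine op_ext (e := e) fun k => eq_of_inner_basis (e := e) fun m => ?_
    rw [op_mul_apply, op_mul_apply, hP, blockProj_basis]
    by_cases h0 : inner ℂ (e m) (T (e k)) = 0
    · split_ifs <;> simp [h0]
    · have hkm := (exists_block_iff k m).1 (h k m h0)
      rw [hkm]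
      split_ifs <;> simp
  · intro h k m h0
    rw [exists_block_iff]
    by_contra hkm
    apply h0
    have := congrArg (fun S : BL2 => inner ℂ (e m) (S (e k))) (h {k / 2})
    simp only [op_mul_apply, hP, blockProj_basis] at this
    rw [if_neg (by simpa using fun h => hkm h.symm), if_pos (by simp)] at this
    exact this.symm

theorem mem_blockSetOn_iff {X : Set ℕ} {T : BL2} :
    T ∈ blockSetOn e X ↔ T ∈ blockSet e ∧ T * blockProj e X = T := by
  classical
  refine and_congr_right fun hT => ⟨fun h => ?_, fun h n hn => ?_⟩
  · refine op_ext (e := e) fun k => ?_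
    rw [op_mul_apply, blockProj_basis]
    split_ifs with hk
    · rfl
    · rw [map_zero]
      rcases Nat.even_or_odd' k with ⟨n, rfl | rfl⟩
      · exact (h n (by convert hk using 2; omega)).1.symm
      · exact (h n (by convert hk using 2; omega)).2.symm
  · rw [← h]
    constructor <;> rw [op_mul_apply, blockProj_basis, if_neg, map_zero] <;>
      · convert hn using 2; omega

theorem blockSet_add {S T : BL2} (hS : S ∈ blockSet e) (hT : T ∈ blockSet e) :
    S + T ∈ blockSet e := by
  rw [mem_blockSet_iff] at *
  intro X
  rw [mul_add, add_mul, hS, hT]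

theorem blockSet_mul {S T : BL2} (hS : S ∈ blockSet e) (hT : T ∈ blockSet e) :
    S * T ∈ blockSet e := by
  rw [mem_blockSet_iff] at *
  intro X
  rw [← mul_assoc, hS, mul_assoc, hT, mul_assoc]

theorem blockSet_star {T : BL2} (hT : T ∈ blockSet e) : star T ∈ blockSet e := by
  rw [mem_blockSet_iff] at *
  intro X
  have := congrArg star (hT X)
  rw [star_mul, star_mul, star_blockProj] at this
  exact this.symm

theorem blockSet_algebraMap (c : ℂ) : algebraMap ℂ BL2 c ∈ blockSet e := by
  rw [mem_blockSet_iff]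
  exact fun X => (Algebra.commutes c _).symm

theorem blockSet_blockProj (X : Set ℕ) : blockProj e X ∈ blockSet e := by
  classical
  intro k m h
  rw [exists_block_iff]
  rw [blockProj_basis] at h
  split_ifs at h
  · rw [inner_basis] at h
    split_ifs at h with hmk
    · rw [hmk]
    · exact absurd rfl h
  · simp at h

theorem blockSetOn_add {X : Set ℕ} {S T : BL2} (hS : S ∈ blockSetOn e X)
    (hT : T ∈ blockSetOn e X) : S + T ∈ blockSetOn e X := by
  rw [mem_blockSetOn_iff] at *
  exact ⟨blockSet_add hS.1 hT.1, by rw [add_mul, hS.2, hT.2]⟩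

theorem blockSetOn_mul {X : Set ℕ} {S T : BL2} (hS : S ∈ blockSetOn e X)
    (hT : T ∈ blockSetOn e X) : S * T ∈ blockSetOn e X := by
  rw [mem_blockSetOn_iff] at *
  exact ⟨blockSet_mul hS.1 hT.1, by rw [mul_assoc, hT.2]⟩

theorem blockSetOn_star {X : Set ℕ} {T : BL2} (hT : T ∈ blockSetOn e X) :
    star T ∈ blockSetOn e X := by
  rw [mem_blockSetOn_iff] at *
  refine ⟨blockSet_star hT.1, ?_⟩
  have h1 := (mem_blockSet_iff.1 hT.1) X
  rw [← star_blockProj, ← star_mul, h1, hT.2]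

theorem param_sq (α : Param) :
    ((α : ℝ) : ℂ) * ((α : ℝ) : ℂ)
      + ((√(1 - (α : ℝ) ^ 2) : ℝ) : ℂ) * ((√(1 - (α : ℝ) ^ 2) : ℝ) : ℂ) = 1 := by
  have h1 := α.2.1
  have h2 := α.2.2
  have : (α : ℝ) * α + √(1 - (α : ℝ) ^ 2) * √(1 - (α : ℝ) ^ 2) = 1 := by
    rw [Real.mul_self_sqrt (by nlinarith)]; ring
  exact_mod_cast this

theorem inner_rotOdd_rotEven (α : Param) (n : ℕ) :
    inner ℂ (rotOdd e α n) (rotEven e α n) = 0 := by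
  simp only [rotOdd, rotEven, inner_sub_left, inner_add_right, inner_smul_left, inner_smul_right,
    inner_basis, Complex.conj_ofReal]
  simp
  ring

theorem basis_eq_rot (α : Param) (n : ℕ) :
    e (2 * n) = ((α : ℝ) : ℂ) • rotEven e α n + ((√(1 - (α : ℝ) ^ 2) : ℝ) : ℂ) • rotOdd e α n ∧
    e (2 * n + 1)
      = ((√(1 - (α : ℝ) ^ 2) : ℝ) : ℂ) • rotEven e α n - ((α : ℝ) : ℂ) • rotOdd e α n := by
  have h := param_sq α
  constructor
  · calc e (2 * n) = (1 : ℂ) • e (2 * n) := (one_smul _ _).symm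
      _ = _ := by rw [← h, rotEven, rotOdd]; module
  · calc e (2 * n + 1) = (1 : ℂ) • e (2 * n + 1) := (one_smul _ _).symm
      _ = _ := by rw [← h, rotEven, rotOdd]; module

theorem eq_zero_of_inner_rot (α : Param) (n : ℕ) {x : L2}
    (h0 : inner ℂ (rotEven e α n) x = 0) (h1 : inner ℂ (rotOdd e α n) x = 0)
    (h : ∀ m, m / 2 ≠ n → inner ℂ (e m) x = 0) : x = 0 := by
  refine eq_of_inner_basis (e := e) fun m => ?_
  rw [inner_zero_right]
  by_cases hm : m / 2 = n
  · have : m = 2 * n ∨ m = 2 * n + 1 := by omega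
    rcases this with rfl | rfl
    · rw [(basis_eq_rot α n).1, inner_add_left, inner_smul_left, inner_smul_left, h0, h1]
      simp
    · rw [(basis_eq_rot α n).2, inner_sub_left, inner_smul_left, inner_smul_left, h0, h1]
      simp
  · exact h m hm

theorem inner_basis_rot (α : Param) (n m : ℕ) (hm : m / 2 ≠ n) :
    inner ℂ (e m) (rotEven e α n) = 0 ∧ inner ℂ (e m) (rotOdd e α n) = 0 := by
  have h0 : m ≠ 2 * n := by omega
  have h1 : m ≠ 2 * n + 1 := by omega
  constructor <;>
    simp [rotEven, rotOdd, inner_add_right, inner_sub_right, inner_smul_right, inner_basis, h0, h1]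

theorem inner_apply_basis_rot {T : BL2} (hT : T ∈ blockSet e) (α : Param) (n m : ℕ)
    (hm : m / 2 ≠ n) :
    inner ℂ (T (e m)) (rotEven e α n) = 0 ∧ inner ℂ (T (e m)) (rotOdd e α n) = 0 := by
  have h : ∀ k, k / 2 = n → inner ℂ (T (e m)) (e k) = 0 := by
    intro k hk
    rw [← inner_conj_symm]
    by_contra h0
    have : inner ℂ (e k) (T (e m)) ≠ 0 := fun h' => h0 (by rw [h', map_zero])
    have := (exists_block_iff m k).1 (hT m k this)
    omega
  have h0 := h (2 * n) (by omega)
  have h1 := h (2 * n + 1) (by omega)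
  simp [rotEven, rotOdd, inner_add_right, inner_sub_right, inner_smul_right, h0, h1]

theorem rotDiag_add {X : Set ℕ} {α : Param} {S T : BL2} (hS : S ∈ rotDiag e X α)
    (hT : T ∈ rotDiag e X α) : S + T ∈ rotDiag e X α := by
  refine ⟨blockSetOn_add hS.1 hT.1, fun n hn => ?_⟩
  obtain ⟨⟨c, hc⟩, d, hd⟩ := hS.2 n hn
  obtain ⟨⟨c', hc'⟩, d', hd'⟩ := hT.2 n hn
  exact ⟨⟨c + c', by rw [add_apply, hc, hc', add_smul]⟩,
    d + d', by rw [add_apply, hd, hd', add_smul]⟩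

theorem rotDiag_mul {X : Set ℕ} {α : Param} {S T : BL2} (hS : S ∈ rotDiag e X α)
    (hT : T ∈ rotDiag e X α) : S * T ∈ rotDiag e X α := by
  refine ⟨blockSetOn_mul hS.1 hT.1, fun n hn => ?_⟩
  obtain ⟨⟨c, hc⟩, d, hd⟩ := hS.2 n hn
  obtain ⟨⟨c', hc'⟩, d', hd'⟩ := hT.2 n hn
  exact ⟨⟨c' * c, by rw [op_mul_apply, hc', map_smul, hc, smul_smul]⟩,
    d' * d, by rw [op_mul_apply, hd', map_smul, hd, smul_smul]⟩

theorem rotDiag_star {X : Set ℕ} {α : Param} {T : BL2} (hT : T ∈ rotDiag e X α) :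
    star T ∈ rotDiag e X α := by
  refine ⟨blockSetOn_star hT.1, fun n hn => ?_⟩
  obtain ⟨⟨c, hc⟩, d, hd⟩ := hT.2 n hn
  have h01 := inner_rotOdd_rotEven (e := e) α n
  have h10 : inner ℂ (rotEven e α n) (rotOdd e α n) = 0 := by
    rw [← inner_conj_symm, h01, map_zero]
  refine ⟨⟨star c, ?_⟩, star d, ?_⟩ <;> rw [← sub_eq_zero] <;>
    apply eq_zero_of_inner_rot (e := e) α n
  · rw [inner_sub_right, inner_star_right, hc, inner_smul_left, inner_smul_right]; simp
  · rw [inner_sub_right, inner_star_right, hd, inner_smul_left, inner_smul_right, h01]; simp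
  · intro m hm
    rw [inner_sub_right, inner_star_right, inner_smul_right,
      (inner_apply_basis_rot hT.1.1 α n m hm).1, (inner_basis_rot α n m hm).1]; simp
  · rw [inner_sub_right, inner_star_right, hc, inner_smul_left, inner_smul_right, h10]; simp
  · rw [inner_sub_right, inner_star_right, hd, inner_smul_left, inner_smul_right]; simp
  · intro m hm
    rw [inner_sub_right, inner_star_right, inner_smul_right,
      (inner_apply_basis_rot hT.1.1 α n m hm).2, (inner_basis_rot α n m hm).2]; simp

theorem rotDiagCompact_add {X : Set ℕ} {α : Param} {S T : BL2} (hS : S ∈ rotDiagCompact e X α)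
    (hT : T ∈ rotDiagCompact e X α) : S + T ∈ rotDiagCompact e X α := by
  obtain ⟨hS0, S1, hS1, S2, hS2, hSc, rfl⟩ := hS
  obtain ⟨hT0, T1, hT1, T2, hT2, hTc, rfl⟩ := hT
  exact ⟨blockSetOn_add hS0 hT0, S1 + T1, rotDiag_add hS1 hT1, S2 + T2, blockSetOn_add hS2 hT2,
    hSc.add hTc, by abel⟩

theorem rotDiagCompact_mul {X : Set ℕ} {α : Param} {S T : BL2} (hS : S ∈ rotDiagCompact e X α)
    (hT : T ∈ rotDiagCompact e X α) : S * T ∈ rotDiagCompact e X α := by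
  obtain ⟨hS0, S1, hS1, S2, hS2, hSc, rfl⟩ := hS
  obtain ⟨hT0, T1, hT1, T2, hT2, hTc, rfl⟩ := hT
  refine ⟨blockSetOn_mul hS0 hT0, S1 * T1, rotDiag_mul hS1 hT1, S1 * T2 + S2 * (T1 + T2),
    blockSetOn_add (blockSetOn_mul hS1.1 hT2) (blockSetOn_mul hS2 hT0), ?_, by noncomm_ring⟩
  exact IsCompactOperator.add (hTc.clm_comp S1) (hSc.comp_clm (T1 + T2))

theorem rotDiagCompact_star {X : Set ℕ} {α : Param} {T : BL2} (hT : T ∈ rotDiagCompact e X α) :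
    star T ∈ rotDiagCompact e X α := by
  obtain ⟨hT0, T1, hT1, T2, hT2, hTc, rfl⟩ := hT
  exact ⟨blockSetOn_star hT0, star T1, rotDiag_star hT1, star T2, blockSetOn_star hT2,
    isCompactOperator_star hTc, star_add _ _⟩

theorem rotDiagCompact_smul_blockProj (X : Set ℕ) (α : Param) (c : ℂ) :
    c • blockProj e X ∈ rotDiagCompact e X α := by
  classical
  have h0 : c • blockProj e X ∈ blockSetOn e X := by
    rw [mem_blockSetOn_iff]
    refine ⟨?_, by rw [smul_mul_assoc, blockProj_mul_self]⟩
    rw [Algebra.smul_def]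
    exact blockSet_mul (blockSet_algebraMap c) (blockSet_blockProj X)
  have hz : (0 : BL2) ∈ blockSetOn e X := by
    rw [mem_blockSetOn_iff]
    exact ⟨by simpa using blockSet_algebraMap (e := e) 0, zero_mul _⟩
  refine ⟨h0, c • blockProj e X, ⟨h0, fun n hn => ⟨⟨c, ?_⟩, c, ?_⟩⟩, 0, hz,
    isCompactOperator_zero, (add_zero _).symm⟩
  all_goals
    have h1 : (2 * n) / 2 ∈ X := by convert hn using 1; omega
    have h2 : (2 * n + 1) / 2 ∈ X := by convert hn using 1; omega
    simp only [rotEven, rotOdd, smul_apply, map_add, map_sub, map_smul,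
      blockProj_basis, if_pos h1, if_pos h2]
    module

variable (e)

/-- The algebra attached to a family `𝒳` of sets and a system `𝔄` of parameters, as a
`*`-subalgebra of the bounded operators. -/
def masaAlg {𝒳 : Set (Set ℕ)} (𝔄 : 𝒳 → Param) : StarSubalgebra ℂ BL2 where
  carrier := masaSet e 𝔄
  add_mem' {S T} hS hT := ⟨blockSet_add hS.1 hT.1, fun X => by
    rw [mul_add, add_mul]
    exact rotDiagCompact_add (hS.2 X) (hT.2 X)⟩
  mul_mem' {S T} hS hT := ⟨blockSet_mul hS.1 hT.1, fun X => by
    have h : blockProj e X * (S * T) * blockProj e X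
        = (blockProj e X * S * blockProj e X) * (blockProj e X * T * blockProj e X) := by
      have hT' := mem_blockSet_iff.1 hT.1 X
      symm
      calc (blockProj e X * S * blockProj e X) * (blockProj e X * T * blockProj e X)
          = blockProj e X * S * ((blockProj e X * blockProj e X) * T * blockProj e X) := by
            noncomm_ring
        _ = blockProj e X * S * (T * blockProj e X) := by
            rw [blockProj_mul_self, hT', mul_assoc T, blockProj_mul_self]
        _ = blockProj e X * (S * T) * blockProj e X := by
            noncomm_ring
    rw [h]
    exact rotDiagCompact_mul (hS.2 X) (hT.2 X)⟩
  algebraMap_mem' c := ⟨blockSet_algebraMap c, fun X => by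
    rw [Algebra.algebraMap_eq_smul_one, mul_smul_comm, mul_one, smul_mul_assoc, blockProj_mul_self]
    exact rotDiagCompact_smul_blockProj _ _ _⟩
  star_mem' {T} hT := ⟨blockSet_star hT.1, fun X => by
    have := rotDiagCompact_star (hT.2 X)
    rwa [star_mul, star_mul, star_blockProj, ← mul_assoc] at this⟩

/-- The image of that algebra in the Calkin algebra. -/
def calkinMasa {𝒳 : Set (Set ℕ)} (𝔄 : 𝒳 → Param) : StarSubalgebra ℂ Calkin :=
  (masaAlg e 𝔄).map calkinMap

end Blocks

/-! ### The families of sets indexed by subsets of the Cantor space -/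

open TopologicalSpace (Clopens)

/-- The sequence recording which primes divide `n`; primes are enumerated from index `0`. -/
def divPattern (n : ℕ) : ℕ → Bool := fun k => decide (Nat.nth Nat.Prime k ∣ n)

/-- The Boolean homomorphism from the clopen subsets of the Cantor space to the subsets of `ℕ`
that sends `{x | x k = 1}` to the set of multiples of the `k`-th prime. -/
def h0 : BoundedLatticeHom (Clopens (ℕ → Bool)) (Set ℕ) where
  toFun U := {n | divPattern n ∈ U}
  map_sup' _ _ := rfl
  map_inf' _ _ := rfl
  map_top' := rfl
  map_bot' := rfl

/-- The clopen set of all sequences with `k`-th coordinate `1`. -/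
def coordClopen (k : ℕ) : Clopens (ℕ → Bool) where
  carrier := {x | x k = true}
  isClopen' := (isClopen_discrete {true}).preimage (continuous_apply k)

theorem h0_coordClopen (k : ℕ) : h0 (coordClopen k) = {n | Nat.nth Nat.Prime k ∣ n} := by
  ext n
  exact decide_eq_true_iff

/-- The basic clopen set of all sequences that agree with `x` below `n`. -/
def cyl (x : ℕ → Bool) (n : ℕ) : Clopens (ℕ → Bool) where
  carrier := {y | ∀ i < n, y i = x i}
  isClopen' := by
    have : {y : ℕ → Bool | ∀ i < n, y i = x i} = ⋂ i ∈ Set.Iio n, {y | y i = x i} := by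
      ext y; simp
    rw [this]
    exact (Set.finite_Iio n).isClopen_biInter fun i _ =>
      (isClopen_discrete {x i}).preimage (continuous_apply i)

theorem h0_injective : Function.Injective h0 := by
  have hd : DenseRange divPattern := by
    rw [DenseRange, dense_iff_inter_open]
    rintro U hU ⟨x, hx⟩
    obtain ⟨_, ⟨y, n, rfl⟩, hxy, hsub⟩ :=
      (PiNat.isTopologicalBasis_cylinders (fun _ => Bool)).exists_subset_of_mem_open hx hU
    classical
    refine ⟨divPattern (∏ i ∈ (Finset.range n).filter (fun i => y i = true),
      Nat.nth Nat.Prime i), hsub ?_, ⟨_, rfl⟩⟩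
    rw [PiNat.mem_cylinder_iff]
    intro i hi
    have hp : ∀ i, (Nat.nth Nat.Prime i).Prime := Nat.prime_nth_prime
    rw [divPattern, Bool.eq_iff_iff, decide_eq_true_iff, (hp i).prime.dvd_finsetProd_iff]
    constructor
    · rintro ⟨j, hj, hij⟩
      have := Nat.nth_injective Nat.infinite_setOfPred_prime
        ((Nat.prime_dvd_prime_iff_eq (hp i) (hp j)).1 hij)
      subst this
      exact (Finset.mem_filter.1 hj).2
    · exact fun hy => ⟨i, Finset.mem_filter.2 ⟨Finset.mem_range.2 hi, hy⟩, dvd_rfl⟩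
  intro U V h
  have key : ∀ W : Clopens (ℕ → Bool),
      (W : Set (ℕ → Bool)) = closure (W ∩ Set.range divPattern) := fun W =>
    (hd.open_subset_closure_inter W.isClopen.isOpen).antisymm
      (closure_minimal Set.inter_subset_left W.isClopen.isClosed)
  have hi : (U : Set (ℕ → Bool)) ∩ Set.range divPattern = (V : Set (ℕ → Bool)) ∩ Set.range divPattern := by
    ext z
    refine and_congr_left ?_
    rintro ⟨n, rfl⟩
    exact Set.ext_iff.1 h n
  apply SetLike.coe_injective
  rw [key U, key V, hi]

/-- The infinite sets that are almost contained in `h0 (cyl x n)` for every `n`. -/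
def pointFamily (x : ℕ → Bool) : Set (Set ℕ) :=
  {X | X.Infinite ∧ ∀ n, (X \ h0 (cyl x n)).Finite}

/-- `𝒴` is an almost disjoint family, infinite, consisting of members of `𝒳`, and
maximal among the almost disjoint subfamilies of `𝒳`. -/
def IsInfiniteMAD (𝒳 𝒴 : Set (Set ℕ)) : Prop :=
  𝒴.Infinite ∧
    Maximal (fun 𝒵 : Set (Set ℕ) => 𝒵 ⊆ 𝒳 ∧ 𝒵.Pairwise fun X Y => (X ∩ Y).Finite) 𝒴

/-- All sets of `pointFamily x` for `x ∈ a`, and the chosen families `𝒴 x` for `x ∉ a`. -/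
def unionFamily (𝒴 : (ℕ → Bool) → Set (Set ℕ)) (a : Set (ℕ → Bool)) : Set (Set ℕ) :=
  (⋃ x ∈ a, pointFamily x) ∪ ⋃ x ∈ aᶜ, 𝒴 x

/-- The system `𝔄` of parameters has as its fibres exactly the families `pointFamily x` for
`x ∈ a` and the singletons of members of `𝒴 x` for `x ∉ a`. -/
def HasFibres (𝒴 : (ℕ → Bool) → Set (Set ℕ)) (a : Set (ℕ → Bool))
    (𝔄 : unionFamily 𝒴 a → Param) : Prop :=
  Set.range (fun r : Param => ((↑) : unionFamily 𝒴 a → Set ℕ) '' (𝔄 ⁻¹' {r})) =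
    pointFamily '' a ∪ (fun X : Set ℕ => ({X} : Set (Set ℕ))) '' (⋃ x ∈ aᶜ, 𝒴 x)

end

end CalkinMasa

/-!
The algebra attached to a family consists of block diagonal operators, so everything is read off
from the sequence `blk e T` of two by two blocks: passing to the Calkin algebra identifies two
block diagonal operators whose blocks are asymptotically equal (`calkinMap_eq_iff_tendsto`), and
`T` belongs to the algebra exactly when its blocks, written in the basis rotated by `𝔄 X`, become
diagonal along `X` for every `X` in the family (`mem_masaSet_iff`).

*Masa.* By compactness of the Cantor space and maximality of the families `𝒴 x`, every infinite
set meets some member of the family in an infinite set (`unionFamily_dense`), so commutators have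
null blocks. Conversely, an operator commuting with the algebra modulo compact operators commutes
in particular with all block projections modulo compact operators, hence is a compact perturbation
of a block diagonal operator (`exists_blockSet_sub_compact`, a gliding hump argument). Members with
different parameters are almost disjoint (`HasFibres.finite_inter`), so for each `X` the algebra
contains the projection onto the first rotated vectors of the blocks in `X`. Commuting with it
forces the blocks to be asymptotically diagonal along `X`.

*Non-isomorphism.* The algebra contains a copy of the countable algebra of clopen subsets of the
Cantor space. Relative to this copy, the set `a` is recovered from the algebra: `x ∈ a` if and only
if orthogonal sequences of projections concentrated at `x` can be separated (`SeparatesAt`). For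
`x ∈ a` a single rotated basis serves all elements concentrated at `x`, and a diagonal argument
applies (`separatesAt_of_mem`). For `x ∉ a` the first and the second rotated projections over
infinitely many members of `𝒴 x` cannot be separated, because their parameters accumulate
(`not_separatesAt_of_notMem`). An isomorphism onto the algebra of `b` thus determines `a` through a
map from a countable set to a set of size at most continuum, so each isomorphism class has at most
continuum many members (`mk_isomorphic_le`), and there must be `2 ^ 𝔠` classes.
-/

namespace CalkinMasa

noncomputable section

open Filter Topology
open TopologicalSpace (Clopens)

variable {e : HilbertBasis ℕ ℂ L2}

/-! ### Diagonal operators and the operator with prescribed blocks -/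

theorem sum_norm_mul_le {c : ℕ → ℂ} {C : ℝ} (hC : 0 ≤ C) (hc : ∀ k, ‖c k‖ ≤ C) (x : L2)
    (s : Finset ℕ) : ∑ k ∈ s, ‖c k * x k‖ ^ (2 : ENNReal).toReal
      ≤ (C * ‖x‖) ^ (2 : ENNReal).toReal := by
  rw [Real.mul_rpow hC (norm_nonneg x)]
  refine le_trans ?_ (mul_le_mul_of_nonneg_left (lp.sum_rpow_le_norm_rpow (by simp) x s)
    (Real.rpow_nonneg hC _))
  rw [Finset.mul_sum]
  refine Finset.sum_le_sum fun k _ => ?_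
  rw [← Real.mul_rpow hC (norm_nonneg _), norm_mul]
  exact Real.rpow_le_rpow (by positivity)
    (mul_le_mul_of_nonneg_right (hc k) (norm_nonneg _)) (by simp)

/-- The operator on `ℓ²` multiplying the `k`-th coordinate by `c k`, for bounded `c`. -/
def coordMul (c : ℕ → ℂ) (C : ℝ) (hC : 0 ≤ C) (hc : ∀ k, ‖c k‖ ≤ C) : BL2 :=
  LinearMap.mkContinuous
    { toFun := fun x => ⟨fun k => c k * x k, memℓp_gen' (sum_norm_mul_le hC hc x)⟩
      map_add' := fun x y => by ext k; exact mul_add _ _ _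
      map_smul' := fun a x => by ext k; exact mul_left_comm _ _ _ } C
    fun x => lp.norm_le_of_forall_sum_le (by simp) (by positivity) (sum_norm_mul_le hC hc x)

theorem coordMul_apply (c : ℕ → ℂ) (C : ℝ) (hC : 0 ≤ C) (hc : ∀ k, ‖c k‖ ≤ C) (x : L2) (k : ℕ) :
    coordMul c C hC hc x k = c k * x k := rfl

theorem norm_coordMul_le (c : ℕ → ℂ) (C : ℝ) (hC : 0 ≤ C) (hc : ∀ k, ‖c k‖ ≤ C) :
    ‖coordMul c C hC hc‖ ≤ C := LinearMap.mkContinuous_norm_le _ hC _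

theorem exists_diagonal (e : HilbertBasis ℕ ℂ L2) {c : ℕ → ℂ} {C : ℝ} (hC : 0 ≤ C)
    (hc : ∀ k, ‖c k‖ ≤ C) : ∃ T : BL2, ‖T‖ ≤ C ∧ ∀ k, T (e k) = c k • e k := by
  refine ⟨e.repr.symm.toContinuousLinearEquiv.toContinuousLinearMap ∘L coordMul c C hC hc ∘L
    e.repr.toContinuousLinearEquiv.toContinuousLinearMap, ?_, fun k => ?_⟩
  · refine ContinuousLinearMap.opNorm_le_bound _ hC fun x => ?_
    simp only [ContinuousLinearMap.comp_apply, ContinuousLinearEquiv.coe_coe,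
      LinearIsometryEquiv.coe_toContinuousLinearEquiv, LinearIsometryEquiv.norm_map]
    refine ((coordMul c C hC hc).le_opNorm _).trans ?_
    rw [LinearIsometryEquiv.norm_map]
    exact mul_le_mul_of_nonneg_right (norm_coordMul_le c C hC hc) (norm_nonneg _)
  · simp only [ContinuousLinearMap.comp_apply, ContinuousLinearEquiv.coe_coe,
      LinearIsometryEquiv.coe_toContinuousLinearEquiv, HilbertBasis.repr_self]
    rw [← e.repr_symm_single k, ← map_smul]
    congr 1
    ext m
    rw [coordMul_apply]
    by_cases h : m = k
    · subst h; simp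
    · simp [h]

/-- The index of the other basis vector in the block of the `k`-th one. -/
def partner (k : ℕ) : ℕ := if k % 2 = 0 then k + 1 else k - 1

theorem partner_partner (k : ℕ) : partner (partner k) = k := by
  unfold partner; split_ifs <;> omega

theorem exists_swap (e : HilbertBasis ℕ ℂ L2) :
    ∃ W : BL2, ‖W‖ ≤ 1 ∧ ∀ k, W (e k) = e (partner k) := by
  have hinv : Function.Involutive partner := partner_partner
  have ho : Orthonormal ℂ (e ∘ partner) := e.orthonormal.comp _ hinv.injective
  have hsp : ⊤ ≤ (Submodule.span ℂ (Set.range (e ∘ partner))).topologicalClosure := by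
    rw [hinv.surjective.range_comp, e.dense_span]
  let e' := HilbertBasis.mk ho hsp
  have he' : ∀ k, e' k = e (partner k) := fun k => by
    rw [HilbertBasis.coe_mk]; rfl
  refine ⟨(e.repr.trans e'.repr.symm).toContinuousLinearEquiv.toContinuousLinearMap, ?_, ?_⟩
  · refine ContinuousLinearMap.opNorm_le_bound _ zero_le_one fun x => ?_
    simp
  · intro k
    rw [← he']
    simp [HilbertBasis.repr_self, HilbertBasis.repr_symm_single]

/-! ### The blocks of an operator -/

/-- The `n`-th two by two block of the matrix of `T` in the basis `e`. -/
def blk (e : HilbertBasis ℕ ℂ L2) (T : BL2) (n : ℕ) : Matrix (Fin 2) (Fin 2) ℂ :=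
  Matrix.of fun i j => inner ℂ (e (2 * n + i)) (T (e (2 * n + j)))

theorem blk_apply (T : BL2) (n : ℕ) (i j : Fin 2) :
    blk e T n i j = inner ℂ (e (2 * n + i)) (T (e (2 * n + j))) := rfl

theorem blk_add (S T : BL2) (n : ℕ) : blk e (S + T) n = blk e S n + blk e T n := by
  ext i j; simp [blk_apply]

theorem blk_sub (S T : BL2) (n : ℕ) : blk e (S - T) n = blk e S n - blk e T n := by
  ext i j; simp [blk_apply]

theorem norm_blk_le (T : BL2) (n : ℕ) (i j : Fin 2) : ‖blk e T n i j‖ ≤ ‖T‖ := by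
  rw [blk_apply]
  refine (norm_inner_le_norm _ _).trans ?_
  rw [e.orthonormal.1, one_mul]
  refine (T.le_opNorm _).trans ?_
  rw [e.orthonormal.1, mul_one]

theorem eq_two_mul_add (k : ℕ) : ∃ (n : ℕ) (i : Fin 2), k = 2 * n + i :=
  ⟨k / 2, ⟨k % 2, Nat.mod_lt _ two_pos⟩, (Nat.div_add_mod k 2).symm⟩

theorem two_mul_add_div (n : ℕ) (i : Fin 2) : (2 * n + (i : ℕ)) / 2 = n := by
  have := i.2; omega

theorem two_mul_add_eq_iff (n : ℕ) (i j : Fin 2) :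
    2 * n + (i : ℕ) = 2 * n + (j : ℕ) ↔ i = j := by
  rw [Fin.ext_iff]; omega

theorem inner_eq_zero_of_mem_blockSet {T : BL2} (hT : T ∈ blockSet e) {k m : ℕ}
    (h : k / 2 ≠ m / 2) : inner ℂ (e m) (T (e k)) = 0 := by
  by_contra h0
  exact h ((exists_block_iff k m).1 (hT k m h0))

theorem blockSet_ext {S T : BL2} (hS : S ∈ blockSet e) (hT : T ∈ blockSet e)
    (h : ∀ n, blk e S n = blk e T n) : S = T := by
  refine op_ext (e := e) fun k => eq_of_inner_basis (e := e) fun m => ?_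
  by_cases hkm : k / 2 = m / 2
  · obtain ⟨n, i, rfl⟩ := eq_two_mul_add k
    obtain ⟨n', j, rfl⟩ := eq_two_mul_add m
    rw [two_mul_add_div, two_mul_add_div] at hkm
    subst hkm
    exact congrFun (congrFun (h n) j) i
  · rw [inner_eq_zero_of_mem_blockSet hS hkm, inner_eq_zero_of_mem_blockSet hT hkm]

theorem apply_basis {T : BL2} (hT : T ∈ blockSet e) (n : ℕ) (j : Fin 2) :
    T (e (2 * n + j)) = ∑ i : Fin 2, blk e T n i j • e (2 * n + i) := by
  refine eq_of_inner_basis (e := e) fun m => ?_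
  rw [inner_sum]
  simp only [inner_smul_right, inner_basis]
  by_cases hm : n = m / 2
  · obtain ⟨n', i, rfl⟩ := eq_two_mul_add m
    rw [two_mul_add_div] at hm
    subst hm
    simp only [two_mul_add_eq_iff, blk_apply, mul_ite, mul_one, mul_zero, Finset.sum_ite_eq,
      Finset.mem_univ, if_true]
  · rw [inner_eq_zero_of_mem_blockSet hT (by rwa [two_mul_add_div])]
    symm
    refine Finset.sum_eq_zero fun i _ => ?_
    rw [if_neg, mul_zero]
    rintro rfl
    exact hm (two_mul_add_div n i).symm

theorem blk_mul {S T : BL2} (hT : T ∈ blockSet e) (n : ℕ) :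
    blk e (S * T) n = blk e S n * blk e T n := by
  ext i j
  rw [blk_apply, op_mul_apply, apply_basis hT, map_sum, inner_sum, Matrix.mul_apply]
  refine Finset.sum_congr rfl fun l _ => ?_
  rw [map_smul, inner_smul_right, blk_apply S, mul_comm]

theorem blk_blockProj (X : Set ℕ) [DecidablePred (· ∈ X)] (n : ℕ) :
    blk e (blockProj e X) n = if n ∈ X then 1 else 0 := by
  ext i j
  rw [blk_apply, blockProj_basis, two_mul_add_div]
  split_ifs
  · simp [inner_basis, Matrix.one_apply, Fin.ext_iff]
  · simp

/-- A bounded sequence of two by two matrices is the sequence of blocks of a block diagonal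
operator `D + F * W`, with `D` and `F` diagonal and `W` swapping the basis vectors of each block. -/
theorem exists_blk_eq (e : HilbertBasis ℕ ℂ L2) {B : ℕ → Matrix (Fin 2) (Fin 2) ℂ} {C : ℝ}
    (hC : 0 ≤ C) (hB : ∀ n i j, ‖B n i j‖ ≤ C) :
    ∃ T ∈ blockSet e, ‖T‖ ≤ 2 * C ∧ ∀ n, blk e T n = B n := by
  obtain ⟨W, hW, hWe⟩ := exists_swap e
  obtain ⟨D, hD, hDe⟩ := exists_diagonal e (c := fun k =>
    B (k / 2) ⟨k % 2, Nat.mod_lt _ two_pos⟩ ⟨k % 2, Nat.mod_lt _ two_pos⟩) hC fun k => hB _ _ _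
  obtain ⟨F, hF, hFe⟩ := exists_diagonal e (c := fun k =>
    B (k / 2) ⟨k % 2, Nat.mod_lt _ two_pos⟩ ⟨partner k % 2, Nat.mod_lt _ two_pos⟩) hC
    fun k => hB _ _ _
  have hT : ∀ n (j : Fin 2), (D + F * W) (e (2 * n + j))
      = ∑ i : Fin 2, B n i j • e (2 * n + i) := by
    intro n j
    rw [Fin.sum_univ_two, add_apply, op_mul_apply, hWe, hDe, hFe]
    have h1 : (2 * n + 1) / 2 = n := by omega
    fin_cases j
    · simp [partner, h1, Nat.add_mod]
    · simp [partner, h1, Nat.add_mod]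
      rw [add_comm]
  refine ⟨D + F * W, ?_, ?_, ?_⟩
  · intro k m h
    rw [exists_block_iff]
    by_contra hkm
    apply h
    obtain ⟨n, i, rfl⟩ := eq_two_mul_add k
    rw [hT, inner_sum]
    refine Finset.sum_eq_zero fun j _ => ?_
    rw [inner_smul_right, inner_basis, if_neg, mul_zero]
    rintro rfl
    simp only [two_mul_add_div] at hkm
    exact hkm trivial
  · refine (norm_add_le _ _).trans ?_
    have := (norm_mul_le F W).trans (mul_le_mul hF hW (norm_nonneg _) hC)
    linarith
  · intro n
    ext i j
    rw [blk_apply, hT, inner_sum]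
    simp [inner_smul_right, inner_basis, ← Fin.ext_iff]

/-! ### Block projections and compactness -/

open Classical in
theorem inner_blockProj (X : Set ℕ) (m : ℕ) (x : L2) :
    inner ℂ (e m) (blockProj e X x) = if m / 2 ∈ X then inner ℂ (e m) x else 0 := by
  rw [← star_blockProj, inner_star_right, blockProj_basis]
  split_ifs <;> simp

theorem blockProj_mul (X Y : Set ℕ) : blockProj e X * blockProj e Y = blockProj e (X ∩ Y) := by
  classical
  refine op_ext (e := e) fun k => ?_
  rw [op_mul_apply, blockProj_basis, blockProj_basis]
  by_cases hY : k / 2 ∈ Y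
  · simp [hY, blockProj_basis]
  · simp [hY]

theorem blockProj_compl (X : Set ℕ) : blockProj e Xᶜ = 1 - blockProj e X := by
  classical
  refine op_ext (e := e) fun k => ?_
  rw [sub_apply, blockProj_basis, blockProj_basis, one_apply_eq_self]
  by_cases hX : k / 2 ∈ X <;> simp [hX]

theorem blockProj_empty : blockProj e ∅ = 0 := by
  classical
  refine op_ext (e := e) fun k => ?_
  rw [blockProj_basis]
  simp

theorem norm_blockProj_le (X : Set ℕ) : ‖blockProj e X‖ ≤ 1 := Submodule.starProjection_norm_le _

theorem norm_blockProj_apply_le (X : Set ℕ) (x : L2) : ‖blockProj e X x‖ ≤ ‖x‖ :=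
  ((blockProj e X).le_of_opNorm_le (norm_blockProj_le X) x).trans (one_mul _).le

theorem blockProj_Iio_apply (N : ℕ) (x : L2) :
    blockProj e (Set.Iio N) x = ∑ k ∈ Finset.range (2 * N), e.repr x k • e k := by
  classical
  refine eq_of_inner_basis (e := e) fun m => ?_
  rw [inner_blockProj, inner_sum]
  simp only [inner_smul_right, inner_basis, mul_ite, mul_one, mul_zero, Finset.sum_ite_eq,
    Finset.mem_range, e.repr_apply_apply, Set.mem_Iio]
  congr 1
  rw [eq_iff_iff]; omega

theorem tendsto_blockProj_Iio (x : L2) :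
    Tendsto (fun N => blockProj e (Set.Iio N) x) atTop (𝓝 x) := by
  have h := (e.hasSum_repr x).tendsto_sum_nat
  have h2 : Tendsto (fun N : ℕ => 2 * N) atTop atTop :=
    tendsto_id.const_mul_atTop' two_pos
  simp only [blockProj_Iio_apply]
  exact h.comp h2

theorem tendsto_blockProj_Ici (x : L2) :
    Tendsto (fun N => blockProj e (Set.Ici N) x) atTop (𝓝 0) := by
  have h := (tendsto_const_nhds (x := x)).sub (tendsto_blockProj_Iio (e := e) x)
  rw [sub_self] at h
  refine h.congr fun N => ?_
  rw [← Set.compl_Iio, blockProj_compl, sub_apply, one_apply_eq_self]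

theorem isCompactOperator_blockProj {F : Set ℕ} (hF : F.Finite) :
    IsCompactOperator (blockProj e F) := by
  unfold blockProj
  set K := (Submodule.span ℂ (⋃ k ∈ F, {e (2 * k), e (2 * k + 1)})).topologicalClosure with hK
  have hfin : FiniteDimensional ℂ K := by
    have : FiniteDimensional ℂ (Submodule.span ℂ (⋃ k ∈ F, {e (2 * k), e (2 * k + 1)})) :=
      FiniteDimensional.span_of_finite ℂ (hF.biUnion fun k _ => by simp)
    rw [hK, (Submodule.closed_of_finiteDimensional _).submodule_topologicalClosure_eq]
    exact this
  have : ProperSpace K := FiniteDimensional.proper ℂ K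
  have h : IsCompactOperator K.subtypeL := isCompactOperator_of_locallyCompactSpace_rng _
  exact h.comp_clm K.orthogonalProjectionOnto

/-- A compact operator maps bounded weakly null families to norm null ones. -/
theorem tendsto_apply_of_isCompactOperator {T : BL2} (hT : IsCompactOperator T) {ι : Type*}
    {l : Filter ι} {v : ι → L2} (hv : ∀ i, ‖v i‖ ≤ 1)
    (hw : ∀ y : L2, Tendsto (fun i => inner ℂ y (v i)) l (𝓝 0)) :
    Tendsto (fun i => T (v i)) l (𝓝 0) := by
  rw [tendsto_iff_ultrafilter]
  intro u hu
  have hc : IsCompact (closure (T '' Metric.closedBall 0 1)) :=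
    IsCompactOperator.isCompact_closure_image_closedBall (f := (T : L2 →ₗ[ℂ] L2)) hT 1
  obtain ⟨y, -, hy⟩ := hc.ultrafilter_le_nhds (u.map fun i => T (v i)) (by
    rw [le_principal_iff]
    rw [Ultrafilter.mem_coe, Ultrafilter.mem_map]
    refine mem_of_superset univ_mem fun i _ => subset_closure ⟨v i, ?_, rfl⟩
    simpa using hv i)
  have hy' : Tendsto (fun i => T (v i)) u (𝓝 y) := hy
  have h1 : Tendsto (fun i => inner ℂ y (T (v i))) u (𝓝 (inner ℂ y y)) :=
    tendsto_const_nhds.inner hy'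
  have h2 : Tendsto (fun i => inner ℂ y (T (v i))) u (𝓝 0) := by
    simp only [← inner_star_left]
    exact (hw _).mono_left hu
  have h0 := tendsto_nhds_unique h1 h2
  rw [inner_self_eq_zero] at h0
  rwa [h0] at hy'

theorem tendsto_inner_basis (y : L2) : Tendsto (fun k => inner ℂ y (e k)) cofinite (𝓝 0) := by
  have h := (e.orthonormal.inner_products_summable y).tendsto_cofinite_zero
  rw [tendsto_zero_iff_norm_tendsto_zero]
  have h' := h.sqrt
  simp only [Real.sqrt_zero, Real.sqrt_sq (norm_nonneg _)] at h'
  simpa only [norm_inner_symm] using h'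

theorem norm_le_of_blk_le {T : BL2} (hT : T ∈ blockSet e) {C : ℝ} (hC : 0 ≤ C)
    (h : ∀ n i j, ‖blk e T n i j‖ ≤ C) : ‖T‖ ≤ 2 * C := by
  obtain ⟨S, hS, hSC, hST⟩ := exists_blk_eq e hC h
  rwa [← blockSet_ext hS hT hST]

theorem isCompactOperator_iff_blk {T : BL2} (hT : T ∈ blockSet e) :
    IsCompactOperator T ↔ ∀ i j, Tendsto (fun n => blk e T n i j) cofinite (𝓝 0) := by
  classical
  constructor
  · intro hc i j
    have h1 := tendsto_apply_of_isCompactOperator hc (fun k => (e.orthonormal.1 k).le)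
      (tendsto_inner_basis (e := e))
    have hinj : Function.Injective fun n : ℕ => 2 * n + (j : ℕ) := fun a b h => by
      simp only at h; omega
    have h2 := (h1.comp hinj.tendsto_cofinite).norm
    rw [norm_zero] at h2
    refine squeeze_zero_norm (fun n => ?_) h2
    rw [blk_apply]
    refine (norm_inner_le_norm _ _).trans ?_
    rw [e.orthonormal.1, one_mul]
    rfl
  · intro h
    have hsmall : ∀ ε > 0, ∃ N, ∀ n ≥ N, ∀ i j, ‖blk e T n i j‖ ≤ ε := by
      intro ε hε
      have : ∀ᶠ n in atTop, ∀ i j, ‖blk e T n i j‖ < ε := by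
        rw [← Nat.cofinite_eq_atTop, eventually_all]
        intro i
        rw [eventually_all]
        intro j
        simpa using (h i j).norm.eventually (gt_mem_nhds (by simpa using hε))
      obtain ⟨N, hN⟩ := eventually_atTop.1 this
      exact ⟨N, fun n hn i j => (hN n hn i j).le⟩
    have hlim : Tendsto (fun N => T * blockProj e (Set.Iio N)) atTop (𝓝 T) := by
      rw [Metric.tendsto_atTop]
      intro ε hε
      obtain ⟨N, hN⟩ := hsmall (ε / 4) (by positivity)
      refine ⟨N, fun M hM => ?_⟩
      have h1 : T - T * blockProj e (Set.Iio M) = T * blockProj e (Set.Ici M) := by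
        rw [← Set.compl_Iio, blockProj_compl, mul_sub, mul_one]
      rw [dist_comm, dist_eq_norm, h1]
      refine (norm_le_of_blk_le (e := e) (C := ε / 4)
        (blockSet_mul hT (blockSet_blockProj _)) (by positivity) ?_).trans_lt (by linarith)
      intro n i j
      rw [blk_mul (blockSet_blockProj _), blk_blockProj]
      split_ifs with hn
      · rw [mul_one]; exact hN n (le_trans hM hn) i j
      · simp; positivity
    exact isCompactOperator_of_tendsto hlim (Eventually.of_forall fun N =>
      (isCompactOperator_blockProj (Set.finite_Iio N)).clm_comp T)

/-! ### Operators commuting with all block projections modulo compact operators -/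

/-- The symmetry that is `-1` on the blocks with index in `Y` and `1` on the others. -/
def blockSymm (e : HilbertBasis ℕ ℂ L2) (Y : Set ℕ) : BL2 := 1 - (2 : ℂ) • blockProj e Y

theorem blockSymm_basis (Y : Set ℕ) [DecidablePred (· ∈ Y)] (k : ℕ) :
    blockSymm e Y (e k) = if k / 2 ∈ Y then -e k else e k := by
  rw [blockSymm, sub_apply, smul_apply, one_apply_eq_self, blockProj_basis]
  split_ifs
  · rw [two_smul]; abel
  · simp

theorem star_blockSymm (Y : Set ℕ) : star (blockSymm e Y) = blockSymm e Y := by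
  rw [blockSymm, star_sub, star_one, star_smul, star_blockProj]
  simp

theorem blockSymm_mul_of_disjoint {Y Z : Set ℕ} (h : Disjoint Y Z) :
    blockSymm e Y * blockSymm e Z = blockSymm e (Y ∪ Z) := by
  classical
  refine op_ext (e := e) fun k => ?_
  rw [op_mul_apply, blockSymm_basis, blockSymm_basis]
  have hd : k / 2 ∈ Y → k / 2 ∉ Z := fun hY => Set.disjoint_left.1 h hY
  by_cases hY : k / 2 ∈ Y <;> by_cases hZ : k / 2 ∈ Z <;>
    simp_all [blockSymm_basis]

theorem inner_blockSymm_conj (Y : Set ℕ) [DecidablePred (· ∈ Y)] (R : BL2) (m k : ℕ) :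
    inner ℂ (e m) ((blockSymm e Y * R * blockSymm e Y) (e k))
      = (if m / 2 ∈ Y then -1 else 1) * (if k / 2 ∈ Y then -1 else 1)
        * inner ℂ (e m) (R (e k)) := by
  rw [op_mul_apply, op_mul_apply, ← star_blockSymm, inner_star_right, blockSymm_basis,
    star_blockSymm, blockSymm_basis]
  split_ifs <;> simp

/-- Averaging over sign changes: if `R` has vanishing diagonal blocks, is supported on the
finite set `F` of blocks, and moves by at most `δ` under conjugation by the symmetries of `F`,
then `‖R‖ ≤ δ`, since the average of the conjugates is zero. -/
theorem norm_le_of_conj_blockSymm_near {R : BL2} {F : Finset ℕ} {δ : ℝ}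
    (hsupp : ∀ m k, m / 2 ∉ F → inner ℂ (e m) (R (e k)) = 0)
    (hdiag : ∀ m k, m / 2 = k / 2 → inner ℂ (e m) (R (e k)) = 0)
    (hnear : ∀ Y ⊆ F, ‖blockSymm e Y * R * blockSymm e Y - R‖ ≤ δ) : ‖R‖ ≤ δ := by
  classical
  -- `A` is the average of the conjugates of `R` by the symmetries of the subsets of `G`
  have key : ∀ G ⊆ F, ∃ A : BL2,
      (∀ Y ⊆ F, Disjoint G Y → ‖blockSymm e Y * A * blockSymm e Y - R‖ ≤ δ) ∧
      (∀ m k, inner ℂ (e m) (R (e k)) = 0 → inner ℂ (e m) (A (e k)) = 0) ∧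
      ∀ m k, m / 2 ≠ k / 2 → m / 2 ∈ G → inner ℂ (e m) (A (e k)) = 0 := by
    intro G
    induction G using Finset.induction_on with
    | empty => exact fun _ => ⟨R, fun Y hY _ => hnear Y hY, fun _ _ h => h, by simp⟩
    | insert j G hj ih =>
      intro hG
      rw [Finset.insert_subset_iff] at hG
      obtain ⟨A, hA1, hA2, hA3⟩ := ih hG.2
      refine ⟨(2⁻¹ : ℂ) • (A + blockSymm e {j} * A * blockSymm e {j}), ?_, ?_, ?_⟩
      · intro Y hY hd
        rw [Finset.disjoint_insert_left] at hd
        have h1 := hA1 Y hY hd.2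
        have h2 := hA1 (insert j Y) (Finset.insert_subset hG.1 hY) (by
          rw [Finset.disjoint_insert_right]; exact ⟨hj, hd.2⟩)
        have hdj : Disjoint ({j} : Set ℕ) (Y : Set ℕ) := by simpa using hd.1
        have e1 : blockSymm e (insert j Y : Finset ℕ)
            = blockSymm e Y * blockSymm e {j} := by
          rw [blockSymm_mul_of_disjoint hdj.symm]
          congr 1; ext x; simp
        have e2 : blockSymm e (insert j Y : Finset ℕ)
            = blockSymm e {j} * blockSymm e Y := by
          rw [blockSymm_mul_of_disjoint hdj]
          congr 1; ext x; simp
        have h3 : blockSymm e Y * ((2⁻¹ : ℂ) • (A + blockSymm e {j} * A * blockSymm e {j}))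
            * blockSymm e Y - R = (2⁻¹ : ℂ) • ((blockSymm e Y * A * blockSymm e Y - R)
              + (blockSymm e (insert j Y : Finset ℕ) * A
                * blockSymm e (insert j Y : Finset ℕ) - R)) := by
          rw [show blockSymm e (insert j Y : Finset ℕ) * A * blockSymm e (insert j Y : Finset ℕ)
            = blockSymm e Y * (blockSymm e {j} * A * blockSymm e {j}) * blockSymm e Y by
              nth_rw 1 [e1]; rw [e2]; noncomm_ring]
          rw [mul_smul_comm, smul_mul_assoc, mul_add, add_mul]
          module
        rw [h3, norm_smul]
        have h4 := norm_add_le (blockSymm e Y * A * blockSymm e Y - R)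
          (blockSymm e (insert j Y : Finset ℕ) * A * blockSymm e (insert j Y : Finset ℕ) - R)
        simp only [norm_inv, RCLike.norm_ofNat]
        linarith
      · intro m k h
        rw [smul_apply, add_apply, inner_smul_right, inner_add_right, inner_blockSymm_conj,
          hA2 m k h]
        simp
      · intro m k hmk hm
        rw [smul_apply, add_apply, inner_smul_right, inner_add_right, inner_blockSymm_conj]
        by_cases hmG : m / 2 ∈ G
        · rw [hA3 m k hmk hmG]; simp
        · have hmj : m / 2 = j := by
            rcases Finset.mem_insert.1 hm with h | h
            · exact h
            · exact absurd h hmG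
          rw [if_pos (by simpa using hmj), if_neg (by simpa using fun h => hmk (hmj.trans h.symm))]
          ring
  obtain ⟨A, hA1, hA2, hA3⟩ := key F subset_rfl
  have hA0 : A = 0 := by
    refine op_ext (e := e) fun k => eq_of_inner_basis (e := e) fun m => ?_
    rw [zero_apply, inner_zero_right]
    by_cases hm : m / 2 ∈ F
    · by_cases hmk : m / 2 = k / 2
      · exact hA2 m k (hdiag m k hmk)
      · exact hA3 m k hmk hm
    · exact hA2 m k (hsupp m k hm)
  have := hA1 ∅ (Finset.empty_subset F) (Finset.disjoint_empty_right F)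
  rw [hA0] at this
  simpa using this

theorem conj_blockSymm_sub {R : BL2} (Y : Set ℕ) :
    blockSymm e Y * R * blockSymm e Y - R
      = (-2 : ℂ) • (blockProj e Y * R * blockProj e Yᶜ + blockProj e Yᶜ * R * blockProj e Y) := by
  rw [blockProj_compl, blockSymm]
  simp only [sub_mul, mul_sub, one_mul, mul_one, smul_mul_assoc, mul_smul_comm, smul_sub]
  module

/-- A finite matrix of blocks with vanishing diagonal has a large rectangular corner away from
the diagonal. -/
theorem exists_corner {S : BL2} (hS : ∀ n, blk e S n = 0) {F : Set ℕ} (hF : F.Finite) {ε : ℝ}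
    (h : ε < ‖blockProj e F * S * blockProj e F‖) :
    ∃ Y ⊆ F, ε / 4 < ‖blockProj e Y * S * blockProj e (F \ Y)‖ := by
  classical
  by_contra! hcon
  refine absurd h (not_lt.2 ?_)
  refine norm_le_of_conj_blockSymm_near (e := e) (F := hF.toFinset) ?_ ?_ ?_
  · intro m k hm
    rw [op_mul_apply, op_mul_apply, inner_blockProj, if_neg (by simpa using hm)]
  · intro m k hmk
    rw [op_mul_apply, op_mul_apply, inner_blockProj, blockProj_basis]
    have : inner ℂ (e m) (S (e k)) = 0 := by
      obtain ⟨n, i, rfl⟩ := eq_two_mul_add m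
      obtain ⟨n', j, rfl⟩ := eq_two_mul_add k
      rw [two_mul_add_div, two_mul_add_div] at hmk
      subst hmk
      exact congrFun (congrFun (hS n) i) j
    split_ifs <;> simp [this]
  · intro Y hY
    have hYF : (Y : Set ℕ) ⊆ F := fun y hy => by simpa using hY hy
    have h1 := hcon Y hYF
    have h2 := hcon (F \ Y) Set.sdiff_subset
    rw [sdiff_sdiff_right_self, inf_eq_right.2 hYF] at h2
    have e1 : blockProj e Y * (blockProj e F * S * blockProj e F) * blockProj e (Y : Set ℕ)ᶜ
        = blockProj e Y * S * blockProj e (F \ Y) := by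
      rw [show blockProj e Y * (blockProj e F * S * blockProj e F) * blockProj e (Y : Set ℕ)ᶜ
        = (blockProj e Y * blockProj e F) * S * (blockProj e F * blockProj e (Y : Set ℕ)ᶜ) by
          noncomm_ring, blockProj_mul, blockProj_mul, Set.inter_eq_left.2 hYF, Set.sdiff_eq]
    have e2 : blockProj e (Y : Set ℕ)ᶜ * (blockProj e F * S * blockProj e F) * blockProj e Y
        = blockProj e (F \ Y) * S * blockProj e Y := by
      rw [show blockProj e (Y : Set ℕ)ᶜ * (blockProj e F * S * blockProj e F) * blockProj e Y
        = (blockProj e (Y : Set ℕ)ᶜ * blockProj e F) * S * (blockProj e F * blockProj e Y) by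
          noncomm_ring, blockProj_mul, blockProj_mul, Set.inter_eq_right.2 hYF, Set.inter_comm,
          Set.sdiff_eq]
    rw [conj_blockSymm_sub, e1, e2, norm_smul]
    have := norm_add_le (blockProj e Y * S * blockProj e (F \ Y))
      (blockProj e (F \ Y) * S * blockProj e Y)
    simp only [norm_neg, RCLike.norm_ofNat]
    linarith

/-- If the corners of `S` over all intervals far out were small, then so would be the corner over
a half-line, which differs from `S` by a compact operator. -/
theorem exists_large_interval {S : BL2} (hS : ¬ IsCompactOperator S) :
    ∃ ε > 0, ∀ n, ∃ p, ε < ‖blockProj e (Set.Ico n p) * S * blockProj e (Set.Ico n p)‖ := by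
  by_contra! hcon
  apply hS
  have hbound : ∀ ε > 0, ∃ n,
      ‖blockProj e (Set.Ici n) * S * blockProj e (Set.Ici n)‖ ≤ ε := by
    intro ε hε
    obtain ⟨n, hn⟩ := hcon ε hε
    refine ⟨n, ContinuousLinearMap.opNorm_le_bound _ hε.le fun x => ?_⟩
    have hlim : ∀ y : L2, Tendsto (fun p => blockProj e (Set.Ico n p) y) atTop
        (𝓝 (blockProj e (Set.Ici n) y)) := by
      intro y
      refine (tendsto_blockProj_Iio (e := e) (blockProj e (Set.Ici n) y)).congr fun p => ?_
      rw [← op_mul_apply, blockProj_mul, Set.inter_comm, Set.Ici_inter_Iio]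
    obtain ⟨z, hz⟩ : ∃ z, z = blockProj e (Set.Ici n) (S (blockProj e (Set.Ici n) x)) := ⟨_, rfl⟩
    have h1 : Tendsto (fun p => blockProj e (Set.Ico n p) (S (blockProj e (Set.Ici n) x)))
        atTop (𝓝 z) := hz ▸ hlim _
    have h2 : Tendsto (fun p => S (blockProj e (Set.Ico n p) x)
        - S (blockProj e (Set.Ici n) x)) atTop (𝓝 0) := by
      rw [← sub_self (S (blockProj e (Set.Ici n) x))]
      exact ((S.continuous.tendsto _).comp (hlim x)).sub tendsto_const_nhds
    have h3 : Tendsto (fun p => blockProj e (Set.Ico n p) (S (blockProj e (Set.Ico n p) x)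
        - S (blockProj e (Set.Ici n) x))) atTop (𝓝 0) :=
      squeeze_zero_norm (fun p => norm_blockProj_apply_le _ _) (by simpa using h2.norm)
    have h4 := (h3.add h1).norm
    rw [zero_add] at h4
    rw [op_mul_apply, op_mul_apply, ← hz]
    refine le_of_tendsto h4 (Eventually.of_forall fun p => ?_)
    rw [map_sub, sub_add_cancel]
    exact ContinuousLinearMap.le_of_opNorm_le _ (hn p) x
  choose n hn using fun j : ℕ => hbound (1 / ((j : ℝ) + 1)) Nat.one_div_pos_of_nat
  have hlim : Tendsto (fun j => S - blockProj e (Set.Ici (n j)) * S * blockProj e (Set.Ici (n j)))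
      atTop (𝓝 S) := by
    rw [tendsto_iff_norm_sub_tendsto_zero]
    refine squeeze_zero (fun _ => norm_nonneg _) (fun j => ?_)
      tendsto_one_div_add_atTop_nhds_zero_nat
    rw [sub_sub_cancel_left, norm_neg]
    exact hn j
  refine isCompactOperator_of_tendsto hlim (Eventually.of_forall fun j => ?_)
  have hc := isCompactOperator_blockProj (e := e) (Set.finite_Iio (n j))
  have : S - blockProj e (Set.Ici (n j)) * S * blockProj e (Set.Ici (n j))
      = blockProj e (Set.Iio (n j)) * S
        + blockProj e (Set.Ici (n j)) * S * blockProj e (Set.Iio (n j)) := by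
    rw [← Set.compl_Iio, blockProj_compl]; noncomm_ring
  rw [this]
  exact IsCompactOperator.add (hc.comp_clm S) (hc.clm_comp (blockProj e (Set.Ici (n j)) * S))

/-- An operator with vanishing diagonal blocks that commutes with all block projections modulo
compact operators is compact: otherwise there are large corners over successive intervals, and
they add up to a corner of `S` that is not compact. -/
theorem isCompactOperator_of_commutator {S : BL2} (hS : ∀ n, blk e S n = 0)
    (hc : ∀ Y, IsCompactOperator (blockProj e Y * S - S * blockProj e Y : BL2)) :
    IsCompactOperator S := by
  by_contra hcon
  obtain ⟨ε, hε, hp⟩ := exists_large_interval (e := e) hcon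
  choose p hp using hp
  have hpn : ∀ n, n ≤ p n := by
    intro n
    by_contra! h
    have := hp n
    rw [Set.Ico_eq_empty (by omega), blockProj_empty] at this
    simp at this
    linarith
  choose Y hYF hY using fun n => exists_corner hS (Set.finite_Ico n (p n)) (hp n)
  have hw : ∀ n, ∃ w : L2, ‖w‖ ≤ 1 ∧
      ε / 4 < ‖(blockProj e (Y n) * S * blockProj e (Set.Ico n (p n) \ Y n)) w‖ := by
    intro n
    obtain ⟨w, hw, h⟩ := ContinuousLinearMap.exists_lt_apply_of_lt_opNorm _ (hY n)
    exact ⟨w, hw.le, h⟩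
  choose w hw1 hw2 using hw
  let N : ℕ → ℕ := fun j => Nat.rec 0 (fun _ m => p m + 1) j
  have hN : ∀ j, N (j + 1) = p (N j) + 1 := fun _ => rfl
  have hNs : StrictMono N := strictMono_nat_of_lt_succ fun j => by
    have := hpn (N j)
    rw [hN]; omega
  let Z : Set ℕ := ⋃ j, Y (N j)
  have hdisj : ∀ j, (Set.Ico (N j) (p (N j)) \ Y (N j)) ⊆ Zᶜ := by
    rintro j x ⟨hx, hxY⟩ hxZ
    obtain ⟨i, hi⟩ := Set.mem_iUnion.1 hxZ
    have hxi := hYF (N i) hi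
    rcases lt_trichotomy i j with h | h | h
    · have := hNs.monotone (Nat.succ_le_of_lt h)
      rw [Nat.succ_eq_add_one, hN] at this
      have h1 := hx.1; have h2 := hxi.2; omega
    · subst h; exact hxY hi
    · have := hNs.monotone (Nat.succ_le_of_lt h)
      rw [Nat.succ_eq_add_one, hN] at this
      have h1 := hx.2; have h2 := hxi.1; omega
  -- bounded vectors with disjoint supports, hence weakly null
  let v : ℕ → L2 := fun j => blockProj e (Set.Ico (N j) (p (N j)) \ Y (N j)) (w (N j))
  have hK : IsCompactOperator (blockProj e Z * S * blockProj e Zᶜ : BL2) := by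
    have : (blockProj e Z * S * blockProj e Zᶜ : BL2)
        = (blockProj e Z * S - S * blockProj e Z) * blockProj e Zᶜ := by
      rw [sub_mul, mul_assoc S, blockProj_mul, Set.inter_compl_self, blockProj_empty, mul_zero,
        sub_zero]
    rw [this]
    exact (hc Z).comp_clm (blockProj e Zᶜ)
  have hlim := tendsto_apply_of_isCompactOperator hK (l := atTop) (v := v)
    (fun j => (norm_blockProj_apply_le _ _).trans (hw1 _)) (by
      intro y
      have h := ((tendsto_blockProj_Ici (e := e) y).comp hNs.tendsto_atTop).norm
      rw [norm_zero] at h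
      refine squeeze_zero_norm (fun j => ?_) h
      have hv : v j = blockProj e (Set.Ici (N j)) (v j) := by
        simp only [v]
        rw [← op_mul_apply, blockProj_mul, Set.inter_eq_right.2]
        exact fun x hx => hx.1.1
      rw [hv, ← star_blockProj, inner_star_right]
      refine (norm_inner_le_norm _ _).trans ?_
      exact mul_le_of_le_one_right (norm_nonneg _)
        ((norm_blockProj_apply_le _ _).trans (hw1 _)))
  have hlim' := hlim.norm
  rw [norm_zero] at hlim'
  obtain ⟨j, hj⟩ := (hlim'.eventually (gt_mem_nhds (show (0 : ℝ) < ε / 4 by positivity))).exists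
  refine absurd hj (not_lt.2 ?_)
  refine (hw2 (N j)).le.trans ?_
  have h1 : (blockProj e (Y (N j)) * S * blockProj e (Set.Ico (N j) (p (N j)) \ Y (N j))) (w (N j))
      = blockProj e (Y (N j)) ((blockProj e Z * S * blockProj e Zᶜ) (v j)) := by
    simp only [v]
    rw [← op_mul_apply, ← op_mul_apply]
    congr 1
    rw [show blockProj e (Y (N j)) * (blockProj e Z * S * blockProj e Zᶜ)
        * blockProj e (Set.Ico (N j) (p (N j)) \ Y (N j))
      = (blockProj e (Y (N j)) * blockProj e Z) * S * (blockProj e Zᶜ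
        * blockProj e (Set.Ico (N j) (p (N j)) \ Y (N j))) by noncomm_ring,
      blockProj_mul, blockProj_mul, Set.inter_eq_right.2 (hdisj j),
      Set.inter_eq_left.2 (Set.subset_iUnion (fun j => Y (N j)) j)]
  rw [h1]
  exact norm_blockProj_apply_le _ _

/-- An operator commuting with all block projections modulo compact operators is a compact
perturbation of its block diagonal part. -/
theorem exists_blockSet_sub_compact {T : BL2}
    (hc : ∀ Y, IsCompactOperator (blockProj e Y * T - T * blockProj e Y : BL2)) :
    ∃ D ∈ blockSet e, IsCompactOperator (T - D : BL2) := by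
  obtain ⟨D, hD, -, hDT⟩ := exists_blk_eq e (norm_nonneg T) (norm_blk_le (e := e) T)
  refine ⟨D, hD, isCompactOperator_of_commutator (e := e) ?_ ?_⟩
  · intro n
    rw [blk_sub, hDT, sub_self]
  · intro Y
    have : blockProj e Y * (T - D) - (T - D) * blockProj e Y
        = blockProj e Y * T - T * blockProj e Y := by
      rw [mul_sub, sub_mul, mem_blockSet_iff.1 hD Y]; abel
    rw [this]
    exact hc Y

/-! ### Rotated blocks and the algebras of asymptotically diagonal operators -/

theorem tendsto_entry {ι : Type*} {l : Filter ι} {B : ι → Matrix (Fin 2) (Fin 2) ℂ}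
    (h : Tendsto B l (𝓝 0)) (i j : Fin 2) : Tendsto (fun n => B n i j) l (𝓝 0) :=
  tendsto_pi_nhds.1 (tendsto_pi_nhds.1 h i) j

theorem tendsto_matrix {ι : Type*} {l : Filter ι} {B : ι → Matrix (Fin 2) (Fin 2) ℂ}
    (h : ∀ i j, Tendsto (fun n => B n i j) l (𝓝 0)) : Tendsto B l (𝓝 0) :=
  tendsto_pi_nhds.2 fun i => tendsto_pi_nhds.2 fun j => h i j

theorem isCompactOperator_iff_tendsto_blk {T : BL2} (hT : T ∈ blockSet e) :
    IsCompactOperator T ↔ Tendsto (blk e T) cofinite (𝓝 0) :=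
  (isCompactOperator_iff_blk hT).trans ⟨tendsto_matrix, tendsto_entry⟩

/-- The self-adjoint unitary matrix whose columns are the coordinates of the rotated basis of a
block. -/
def rotMat (α : ℝ) : Matrix (Fin 2) (Fin 2) ℂ :=
  !![(α : ℂ), ((√(1 - α ^ 2) : ℝ) : ℂ); ((√(1 - α ^ 2) : ℝ) : ℂ), -(α : ℂ)]

theorem rotMat_mul_self (α : Param) : rotMat α * rotMat α = 1 := by
  have h := param_sq α
  ext i j
  fin_cases i <;> fin_cases j <;> simp [rotMat, Matrix.mul_apply, Fin.sum_univ_two]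
  · exact h
  · ring
  · ring
  · rw [add_comm]; exact h

theorem norm_rotMat_le (α : Param) (i j : Fin 2) : ‖rotMat α i j‖ ≤ 1 := by
  have h1 : |(α : ℝ)| ≤ 1 := abs_le.2 ⟨by linarith [α.2.1], α.2.2⟩
  have h2 : |√(1 - (α : ℝ) ^ 2)| ≤ 1 := by
    rw [abs_of_nonneg (Real.sqrt_nonneg _), Real.sqrt_le_one]
    nlinarith [sq_nonneg (α : ℝ)]
  fin_cases i <;> fin_cases j <;> simp [rotMat] <;> assumption

/-- The matrix `B` of a block, rewritten in the rotated basis. As `rotMat α` is an involution,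
the same operation translates back. -/
def conjRot (α : ℝ) (B : Matrix (Fin 2) (Fin 2) ℂ) : Matrix (Fin 2) (Fin 2) ℂ :=
  rotMat α * B * rotMat α

theorem conjRot_conjRot (α : Param) (B : Matrix (Fin 2) (Fin 2) ℂ) :
    conjRot α (conjRot α B) = B := by
  have h := rotMat_mul_self α
  calc _ = (rotMat α * rotMat α) * B * (rotMat α * rotMat α) := by
        simp only [conjRot, mul_assoc]
    _ = B := by rw [h, one_mul, mul_one]

theorem conjRot_mul (α : Param) (B C : Matrix (Fin 2) (Fin 2) ℂ) :
    conjRot α (B * C) = conjRot α B * conjRot α C := by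
  have h := rotMat_mul_self α
  calc _ = rotMat α * B * 1 * C * rotMat α := by simp only [conjRot, mul_assoc, one_mul]
    _ = _ := by rw [← h]; simp only [conjRot, mul_assoc]

theorem conjRot_sub (α : ℝ) (B C : Matrix (Fin 2) (Fin 2) ℂ) :
    conjRot α (B - C) = conjRot α B - conjRot α C := by
  simp only [conjRot, mul_sub, sub_mul]

theorem conjRot_add (α : ℝ) (B C : Matrix (Fin 2) (Fin 2) ℂ) :
    conjRot α (B + C) = conjRot α B + conjRot α C := by
  simp only [conjRot, mul_add, add_mul]

@[simp] theorem conjRot_zero (α : ℝ) : conjRot α 0 = 0 := by simp [conjRot]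

theorem conjRot_one (α : Param) : conjRot α 1 = 1 := by
  rw [conjRot, mul_one, rotMat_mul_self]

theorem continuous_conjRot (α : ℝ) : Continuous (conjRot α) := by
  unfold conjRot; fun_prop

theorem tendsto_conjRot {ι : Type*} {l : Filter ι} {B : ι → Matrix (Fin 2) (Fin 2) ℂ} (α : ℝ)
    (h : Tendsto B l (𝓝 0)) : Tendsto (fun n => conjRot α (B n)) l (𝓝 0) := by
  have := ((continuous_conjRot α).tendsto 0).comp h
  rwa [conjRot_zero] at this

theorem norm_mul_entry_le {A B : Matrix (Fin 2) (Fin 2) ℂ} {a b : ℝ} (ha : 0 ≤ a)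
    (hA : ∀ i j, ‖A i j‖ ≤ a) (hB : ∀ i j, ‖B i j‖ ≤ b) (i j : Fin 2) :
    ‖(A * B) i j‖ ≤ 2 * (a * b) := by
  rw [Matrix.mul_apply, Fin.sum_univ_two]
  refine (norm_add_le _ _).trans ?_
  rw [norm_mul, norm_mul, two_mul]
  exact add_le_add (mul_le_mul (hA _ _) (hB _ _) (norm_nonneg _) ha)
    (mul_le_mul (hA _ _) (hB _ _) (norm_nonneg _) ha)

theorem norm_conjRot_le (α : Param) {B : Matrix (Fin 2) (Fin 2) ℂ} {C : ℝ} (hC : 0 ≤ C)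
    (hB : ∀ i j, ‖B i j‖ ≤ C) (i j : Fin 2) : ‖conjRot α B i j‖ ≤ 4 * C := by
  refine (norm_mul_entry_le (b := 1) (by positivity)
    (norm_mul_entry_le zero_le_one (norm_rotMat_le α) hB) (norm_rotMat_le α) i j).trans ?_
  linarith

theorem rotEven_eq (α : Param) (n : ℕ) :
    rotEven e α n = ∑ i : Fin 2, rotMat α i 0 • e (2 * n + i) := by
  simp [rotEven, rotMat, Fin.sum_univ_two]

theorem rotOdd_eq (α : Param) (n : ℕ) :
    rotOdd e α n = ∑ i : Fin 2, rotMat α i 1 • e (2 * n + i) := by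
  simp [rotOdd, rotMat, Fin.sum_univ_two, sub_eq_add_neg]

theorem apply_sum_basis {T : BL2} (hT : T ∈ blockSet e) (n : ℕ) (v : Fin 2 → ℂ) :
    T (∑ j : Fin 2, v j • e (2 * n + j))
      = ∑ i : Fin 2, (blk e T n).mulVec v i • e (2 * n + i) := by
  simp only [map_sum, map_smul, apply_basis hT, Finset.smul_sum, Matrix.mulVec, dotProduct,
    Finset.sum_smul, smul_smul]
  rw [Finset.sum_comm]
  simp only [mul_comm]

theorem sum_basis_inj (n : ℕ) {v w : Fin 2 → ℂ} :
    ∑ j : Fin 2, v j • e (2 * n + j) = ∑ j : Fin 2, w j • e (2 * n + j) ↔ v = w := by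
  refine ⟨fun h => ?_, fun h => by rw [h]⟩
  ext i
  have hi : ∀ u : Fin 2 → ℂ,
      inner ℂ (e (2 * n + (i : ℕ))) (∑ j : Fin 2, u j • e (2 * n + j)) = u i := by
    intro u
    simp only [inner_sum, inner_smul_right, inner_basis, two_mul_add_eq_iff, mul_ite, mul_one,
      mul_zero, Finset.sum_ite_eq, Finset.mem_univ, if_true]
  rw [← hi v, h, hi w]

/-- The `j`-th rotated basis vector is an eigenvector of the block `B` if and only if the
entries of the rotated block in the `j`-th column off the diagonal vanish. -/
theorem exists_eigen_iff {T : BL2} (hT : T ∈ blockSet e) (α : Param) (n : ℕ) (j : Fin 2) :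
    (∃ c : ℂ, T (∑ i : Fin 2, rotMat α i j • e (2 * n + i))
        = c • ∑ i : Fin 2, rotMat α i j • e (2 * n + i)) ↔
      ∀ i, i ≠ j → conjRot α (blk e T n) i j = 0 := by
  have hR := rotMat_mul_self α
  simp only [apply_sum_basis hT, Finset.smul_sum, smul_smul, sum_basis_inj n (e := e)
    (v := Matrix.mulVec _ _) (w := fun i => _ * rotMat α i j)]
  have hcol : ∀ i, (blk e T n).mulVec (fun i => rotMat α i j) i
      = (blk e T n * rotMat α) i j := fun i => rfl
  constructor
  · rintro ⟨c, hc⟩ i hij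
    have hc' : ∀ l, (blk e T n * rotMat α) l j = c * rotMat α l j := fun l => by
      rw [← hcol, hc]
    rw [conjRot, mul_assoc, Matrix.mul_apply]
    simp only [hc']
    calc ∑ l, rotMat α i l * (c * rotMat α l j) = c * (rotMat α * rotMat α) i j := by
          rw [Matrix.mul_apply, Finset.mul_sum]
          exact Finset.sum_congr rfl fun l _ => by ring
      _ = 0 := by rw [hR, Matrix.one_apply_ne hij, mul_zero]
  · intro h
    refine ⟨conjRot α (blk e T n) j j, funext fun l => ?_⟩
    have h1 : blk e T n * rotMat α = rotMat α * conjRot α (blk e T n) := by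
      rw [conjRot, ← mul_assoc, ← mul_assoc, hR, one_mul]
    rw [hcol, h1, Matrix.mul_apply, Finset.sum_eq_single j, mul_comm]
    · intro i _ hij
      rw [h i hij, mul_zero]
    · simp

theorem mem_blockSetOn_iff_blk {X : Set ℕ} {T : BL2} (hT : T ∈ blockSet e) :
    T ∈ blockSetOn e X ↔ ∀ n ∉ X, blk e T n = 0 := by
  classical
  rw [mem_blockSetOn_iff, and_iff_right hT]
  constructor
  · intro h n hn
    rw [← h, blk_mul (blockSet_blockProj X), blk_blockProj, if_neg hn, mul_zero]
  · intro h
    refine blockSet_ext (e := e) (blockSet_mul hT (blockSet_blockProj X)) hT fun n => ?_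
    rw [blk_mul (blockSet_blockProj X), blk_blockProj]
    split_ifs with hn
    · rw [mul_one]
    · rw [mul_zero, h n hn]

theorem mem_rotDiag_iff {X : Set ℕ} {α : Param} {T : BL2} (hT : T ∈ blockSetOn e X) :
    T ∈ rotDiag e X α ↔ ∀ n ∈ X, ∀ i j, i ≠ j → conjRot α (blk e T n) i j = 0 := by
  rw [rotDiag, Set.mem_ofPred_eq, and_iff_right hT]
  refine forall₂_congr fun n _ => ?_
  rw [rotEven_eq, rotOdd_eq, exists_eigen_iff hT.1, exists_eigen_iff hT.1]
  constructor
  · rintro ⟨h0, h1⟩ i j hij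
    fin_cases j
    · exact h0 i hij
    · exact h1 i hij
  · exact fun h => ⟨fun i hi => h i 0 hi, fun i hi => h i 1 hi⟩

/-- Along `X`, the rotated blocks `B n` become diagonal in the limit. -/
def AsympDiag (α : ℝ) (X : Set ℕ) (B : ℕ → Matrix (Fin 2) (Fin 2) ℂ) : Prop :=
  ∀ i j, i ≠ j → Tendsto (fun n => conjRot α (B n) i j) (cofinite ⊓ 𝓟 X) (𝓝 0)

theorem blk_cut {T : BL2} (hT : T ∈ blockSet e) (X : Set ℕ) [DecidablePred (· ∈ X)] (n : ℕ) :
    blk e (blockProj e X * T * blockProj e X) n = if n ∈ X then blk e T n else 0 := by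
  rw [blk_mul (blockSet_blockProj X), blk_mul hT, blk_blockProj]
  split_ifs <;> simp

theorem tendsto_ite_zero {M : Type*} [Zero M] [TopologicalSpace M] {X : Set ℕ}
    [DecidablePred (· ∈ X)] {B : ℕ → M} :
    Tendsto (fun n => if n ∈ X then B n else 0) cofinite (𝓝 0)
      ↔ Tendsto B (cofinite ⊓ 𝓟 X) (𝓝 0) := by
  constructor
  · intro h
    refine (h.mono_left inf_le_left).congr' ?_
    filter_upwards [mem_inf_of_right (mem_principal_self X)] with n hn
    rw [if_pos hn]
  · intro h
    refine Tendsto.if h ?_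
    exact tendsto_const_nhds

theorem blockProj_cut_mem {T : BL2} (hT : T ∈ blockSet e) (X : Set ℕ) :
    blockProj e X * T * blockProj e X ∈ blockSet e :=
  blockSet_mul (blockSet_mul (blockSet_blockProj X) hT) (blockSet_blockProj X)

theorem cut_mem_rotDiagCompact_iff {X : Set ℕ} {α : Param} {T : BL2} (hT : T ∈ blockSet e) :
    blockProj e X * T * blockProj e X ∈ rotDiagCompact e X α ↔ AsympDiag α X (blk e T) := by
  classical
  have hP := blockProj_cut_mem hT X
  constructor
  · rintro ⟨-, S, hS, R, hR, hRc, hSR⟩ i j hij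
    have h1 := tendsto_entry (tendsto_conjRot α
      ((isCompactOperator_iff_tendsto_blk hR.1).1 hRc)) i j
    refine (h1.mono_left inf_le_left).congr' ?_
    filter_upwards [mem_inf_of_right (mem_principal_self X)] with n hn
    have h2 : blk e T n = blk e S n + blk e R n := by
      rw [← blk_add, ← hSR, blk_cut hT, if_pos hn]
    rw [h2, conjRot_add, Matrix.add_apply, (mem_rotDiag_iff hS.1).1 hS n hn i j hij, zero_add]
  · intro h
    have hPX : blockProj e X * T * blockProj e X ∈ blockSetOn e X := by
      rw [mem_blockSetOn_iff_blk hP]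
      intro n hn
      rw [blk_cut hT, if_neg hn]
    obtain ⟨S, hS, -, hSb⟩ := exists_blk_eq e (B := fun n => if n ∈ X then
      conjRot α (Matrix.diagonal fun i => conjRot α (blk e T n) i i) else 0)
      (C := 4 * (4 * ‖T‖)) (by positivity) (by
        intro n i j
        split_ifs
        · refine norm_conjRot_le α (by positivity) (fun i j => ?_) i j
          by_cases hij : i = j
          · subst hij
            rw [Matrix.diagonal_apply_eq]
            exact norm_conjRot_le α (norm_nonneg T) (norm_blk_le T n) i i
          · rw [Matrix.diagonal_apply_ne _ hij, norm_zero]; positivity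
        · rw [Matrix.zero_apply, norm_zero]; positivity)
    have hSX : S ∈ blockSetOn e X := by
      rw [mem_blockSetOn_iff_blk hS]
      intro n hn
      rw [hSb, if_neg hn]
    have hdiff : blockProj e X * T * blockProj e X - S ∈ blockSet e := by
      rw [sub_eq_add_neg, ← neg_one_smul ℂ S, Algebra.smul_def]
      exact blockSet_add hP (blockSet_mul (blockSet_algebraMap _) hS)
    refine ⟨hPX, S, (mem_rotDiag_iff hSX).2 ?_, blockProj e X * T * blockProj e X - S,
      (mem_blockSetOn_iff_blk hdiff).2 ?_, (isCompactOperator_iff_tendsto_blk hdiff).2 ?_,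
      (add_sub_cancel _ _).symm⟩
    · intro n hn i j hij
      rw [hSb, if_pos hn, conjRot_conjRot, Matrix.diagonal_apply_ne _ hij]
    · intro n hn
      rw [blk_sub, blk_cut hT, hSb, if_neg hn, if_neg hn, sub_self]
    · have h1 : Tendsto (fun n => conjRot α (conjRot α (blk e T n)
          - Matrix.diagonal fun i => conjRot α (blk e T n) i i)) (cofinite ⊓ 𝓟 X) (𝓝 0) := by
        refine tendsto_conjRot α (tendsto_matrix fun i j => ?_)
        by_cases hij : i = j
        · subst hij
          simp only [Matrix.sub_apply, Matrix.diagonal_apply_eq, sub_self]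
          exact tendsto_const_nhds
        · simp only [Matrix.sub_apply, Matrix.diagonal_apply_ne _ hij, sub_zero]
          exact h i j hij
      refine (tendsto_ite_zero.2 h1).congr fun n => ?_
      rw [blk_sub, blk_cut hT, hSb]
      split_ifs
      · rw [conjRot_sub, conjRot_conjRot]
      · rw [sub_self]

/-- Membership in the algebra in terms of the blocks alone. -/
theorem mem_masaSet_iff {𝒳 : Set (Set ℕ)} {𝔄 : 𝒳 → Param} {T : BL2} :
    T ∈ masaSet e 𝔄 ↔ T ∈ blockSet e ∧ ∀ X : 𝒳, AsympDiag (𝔄 X) X (blk e T) :=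
  and_congr_right fun hT => forall_congr' fun _ => cut_mem_rotDiagCompact_iff hT

/-! ### Maximality -/

theorem exists_rotProj (e : HilbertBasis ℕ ℂ L2) (α : Param) (E : Fin 2 → Set ℕ) :
    ∃ T ∈ blockSet e, ∀ n,
      blk e T n = conjRot α (Matrix.diagonal fun i => (E i).indicator 1 n) := by
  classical
  obtain ⟨T, hT, -, h⟩ := exists_blk_eq e
    (B := fun n => conjRot α (Matrix.diagonal fun i => (E i).indicator 1 n)) (C := 4 * 1)
    (by positivity) fun n i j => norm_conjRot_le α zero_le_one (fun i j => by
      rw [Matrix.diagonal_apply, Set.indicator_apply]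
      split_ifs <;> simp) i j
  exact ⟨T, hT, h⟩

/-- The block diagonal projection that is diagonal in the basis rotated by `α` and whose range is
spanned by the first rotated vectors of the blocks in `E 0` and the second ones of those
in `E 1`. -/
def rotProj (e : HilbertBasis ℕ ℂ L2) (α : Param) (E : Fin 2 → Set ℕ) : BL2 :=
  (exists_rotProj e α E).choose

theorem rotProj_mem_blockSet (α : Param) (E : Fin 2 → Set ℕ) : rotProj e α E ∈ blockSet e :=
  (exists_rotProj e α E).choose_spec.1

theorem blk_rotProj (α : Param) (E : Fin 2 → Set ℕ) (n : ℕ) :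
    blk e (rotProj e α E) n = conjRot α (Matrix.diagonal fun i => (E i).indicator 1 n) :=
  (exists_rotProj e α E).choose_spec.2 n

theorem blk_rotProj_eq_zero (α : Param) {E : Fin 2 → Set ℕ} {n : ℕ} (h : ∀ i, n ∉ E i) :
    blk e (rotProj e α E) n = 0 := by
  rw [blk_rotProj, show (Matrix.diagonal fun i => (E i).indicator (1 : ℕ → ℂ) n) = 0 by
    ext i j
    rw [Matrix.diagonal_apply, Set.indicator_of_notMem (h i)]; simp, conjRot_zero]

theorem rotProj_mul (α : Param) (E F : Fin 2 → Set ℕ) :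
    rotProj e α E * rotProj e α F = rotProj e α fun i => E i ∩ F i := by
  refine blockSet_ext (e := e) (blockSet_mul (rotProj_mem_blockSet _ _)
    (rotProj_mem_blockSet _ _)) (rotProj_mem_blockSet _ _) fun n => ?_
  rw [blk_mul (rotProj_mem_blockSet _ _), blk_rotProj, blk_rotProj, blk_rotProj, ← conjRot_mul,
    Matrix.diagonal_mul_diagonal]
  congr 2
  ext i
  rw [Set.inter_indicator_one, Pi.mul_apply]

theorem rotProj_mem_masaSet {𝒳 : Set (Set ℕ)} {𝔄 : 𝒳 → Param} {α : Param} {E : Fin 2 → Set ℕ}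
    (h : ∀ X : 𝒳, 𝔄 X ≠ α → ∀ i, (E i ∩ X).Finite) : rotProj e α E ∈ masaSet e 𝔄 := by
  rw [mem_masaSet_iff]
  refine ⟨rotProj_mem_blockSet _ _, fun X i j hij => ?_⟩
  by_cases hX : 𝔄 X = α
  · simp only [blk_rotProj, hX, conjRot_conjRot, Matrix.diagonal_apply_ne _ hij]
    exact tendsto_const_nhds
  · refine tendsto_const_nhds.congr' ?_
    have hev : ∀ᶠ n in cofinite ⊓ 𝓟 (X : Set ℕ), ∀ i, n ∉ E i := by
      rw [eventually_all]
      intro i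
      rw [eventually_inf_principal, eventually_cofinite]
      refine (h X hX i).subset fun n hn => ?_
      simp only [Set.mem_ofPred_eq, Classical.not_imp, not_not] at hn
      exact ⟨hn.2, hn.1⟩
    filter_upwards [hev] with n hn
    rw [blk_rotProj_eq_zero α hn, conjRot_zero, Matrix.zero_apply]

theorem blockProj_mem_masaSet {𝒳 : Set (Set ℕ)} {𝔄 : 𝒳 → Param} (Y : Set ℕ) :
    blockProj e Y ∈ masaSet e 𝔄 := by
  classical
  rw [mem_masaSet_iff]
  refine ⟨blockSet_blockProj Y, fun X i j hij => ?_⟩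
  refine tendsto_const_nhds.congr fun n => ?_
  rw [blk_blockProj]
  split_ifs
  · rw [conjRot_one, Matrix.one_apply_ne hij]
  · rw [conjRot_zero, Matrix.zero_apply]

theorem calkinMap_eq_iff {S T : BL2} :
    calkinMap S = calkinMap T ↔ IsCompactOperator (S - T : BL2) :=
  (Ideal.Quotient.eq (I := compactIdeal)).trans mem_compactIdeal

theorem calkinMap_surjective : Function.Surjective calkinMap :=
  Ideal.Quotient.mk_surjective (I := compactIdeal)

theorem calkinMap_commute_iff {S T : BL2} :
    calkinMap S * calkinMap T = calkinMap T * calkinMap S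
      ↔ IsCompactOperator (S * T - T * S : BL2) := by
  rw [← map_mul, ← map_mul, calkinMap_eq_iff]

theorem blockSet_sub {S T : BL2} (hS : S ∈ blockSet e) (hT : T ∈ blockSet e) :
    S - T ∈ blockSet e := by
  rw [sub_eq_add_neg, ← neg_one_smul ℂ T, Algebra.smul_def]
  exact blockSet_add hS (blockSet_mul (blockSet_algebraMap _) hT)

/-- For block diagonal operators, equality in the Calkin algebra is asymptotic equality of the
blocks. -/
theorem calkinMap_eq_iff_tendsto {S T : BL2} (hS : S ∈ blockSet e) (hT : T ∈ blockSet e) :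
    calkinMap S = calkinMap T ↔ Tendsto (fun n => blk e S n - blk e T n) cofinite (𝓝 0) := by
  rw [calkinMap_eq_iff, isCompactOperator_iff_tendsto_blk (blockSet_sub hS hT)]
  simp only [← blk_sub]

theorem tendsto_zero_of_bounded_mul {ι : Type*} {l : Filter ι} {u v : ι → ℂ} {C : ℝ}
    (hu : ∀ n, ‖u n‖ ≤ C) (hv : Tendsto v l (𝓝 0)) : Tendsto (fun n => u n * v n) l (𝓝 0) := by
  have h := hv.norm.const_mul C
  rw [norm_zero, mul_zero] at h
  refine squeeze_zero_norm (fun n => ?_) h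
  rw [norm_mul]
  exact mul_le_mul_of_nonneg_right (hu n) (norm_nonneg _)

theorem tendsto_commutator_of_diag {ι : Type*} {l : Filter ι}
    {A B : ι → Matrix (Fin 2) (Fin 2) ℂ} {a b : ℝ} (hA : ∀ n i j, ‖A n i j‖ ≤ a)
    (hB : ∀ n i j, ‖B n i j‖ ≤ b)
    (hA0 : ∀ i j, i ≠ j → Tendsto (fun n => A n i j) l (𝓝 0))
    (hB0 : ∀ i j, i ≠ j → Tendsto (fun n => B n i j) l (𝓝 0)) :
    Tendsto (fun n => A n * B n - B n * A n) l (𝓝 0) := by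
  have h1 : ∀ i j k m, k ≠ m → Tendsto (fun n => A n i j * B n k m) l (𝓝 0) := fun i j k m h =>
    tendsto_zero_of_bounded_mul (fun n => hA n i j) (hB0 k m h)
  have h2 : ∀ i j k m, k ≠ m → Tendsto (fun n => B n i j * A n k m) l (𝓝 0) := fun i j k m h =>
    tendsto_zero_of_bounded_mul (fun n => hB n i j) (hA0 k m h)
  have h01 : (0 : Fin 2) ≠ 1 := by decide
  refine tendsto_matrix fun i j => ?_
  simp only [Matrix.sub_apply, Matrix.mul_apply, Fin.sum_univ_two]
  fin_cases i <;> fin_cases j <;> simp only [Fin.zero_eta, Fin.mk_one]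
  · have := (h1 0 1 1 0 h01.symm).sub (h2 0 1 1 0 h01.symm)
    rw [sub_zero] at this
    exact this.congr fun n => by ring
  · have h3 := ((h1 0 0 0 1 h01).sub (h2 0 0 0 1 h01)).sub ((h1 1 1 0 1 h01).sub (h2 1 1 0 1 h01))
    simp only [sub_zero] at h3
    exact h3.congr fun n => by ring
  · have h3 := ((h1 1 1 1 0 h01.symm).sub (h2 1 1 1 0 h01.symm)).sub
      ((h1 0 0 1 0 h01.symm).sub (h2 0 0 1 0 h01.symm))
    simp only [sub_zero] at h3
    exact h3.congr fun n => by ring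
  · have := (h1 1 0 0 1 h01).sub (h2 1 0 0 1 h01)
    rw [sub_zero] at this
    exact this.congr fun n => by ring

theorem finite_of_eventually {X : Set ℕ} {p : ℕ → Prop} (h : ∀ᶠ n in cofinite ⊓ 𝓟 X, p n) :
    (X ∩ {n | ¬ p n}).Finite := by
  rw [eventually_inf_principal, eventually_cofinite] at h
  exact h.subset fun n hn => by simpa using hn

/-- A sequence that is null along each set of a family meeting every infinite set in an infinite
set is null. -/
theorem tendsto_of_forall_family {E : Type*} [TopologicalSpace E] {x : E} {𝒳 : Set (Set ℕ)}
    (hdense : ∀ Z : Set ℕ, Z.Infinite → ∃ X ∈ 𝒳, (X ∩ Z).Infinite) {f : ℕ → E}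
    (h : ∀ X ∈ 𝒳, Tendsto f (cofinite ⊓ 𝓟 X) (𝓝 x)) : Tendsto f cofinite (𝓝 x) := by
  rw [tendsto_def]
  intro U hU
  by_contra hcon
  rw [mem_cofinite] at hcon
  obtain ⟨X, hX, hXU⟩ := hdense _ hcon
  exact hXU (finite_of_eventually (h X hX hU))

theorem masaSet_commute {𝒳 : Set (Set ℕ)} {𝔄 : 𝒳 → Param}
    (hdense : ∀ Z : Set ℕ, Z.Infinite → ∃ X ∈ 𝒳, (X ∩ Z).Infinite) {S T : BL2}
    (hS : S ∈ masaSet e 𝔄) (hT : T ∈ masaSet e 𝔄) : IsCompactOperator (S * T - T * S : BL2) := by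
  rw [mem_masaSet_iff] at hS hT
  rw [isCompactOperator_iff_tendsto_blk
    (blockSet_sub (blockSet_mul hS.1 hT.1) (blockSet_mul hT.1 hS.1))]
  refine tendsto_of_forall_family hdense fun X hX => ?_
  let α := 𝔄 ⟨X, hX⟩
  have h := tendsto_commutator_of_diag (fun n => norm_conjRot_le α (norm_nonneg S) (norm_blk_le S n))
    (fun n => norm_conjRot_le α (norm_nonneg T) (norm_blk_le T n)) (hS.2 ⟨X, hX⟩) (hT.2 ⟨X, hX⟩)
  refine (tendsto_conjRot α h).congr fun n => ?_
  rw [← conjRot_mul, ← conjRot_mul, ← conjRot_sub, conjRot_conjRot, blk_sub, blk_mul hT.1,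
    blk_mul hS.1]

/-- A block diagonal operator commuting modulo compact operators with the projections that are
diagonal in the prescribed bases lies in the algebra. -/
theorem mem_masaSet_of_commute {𝒳 : Set (Set ℕ)} {𝔄 : 𝒳 → Param}
    (hcoh : ∀ X Y : 𝒳, 𝔄 X ≠ 𝔄 Y → ((X : Set ℕ) ∩ Y).Finite) {D : BL2} (hD : D ∈ blockSet e)
    (h : ∀ Q ∈ masaSet e 𝔄, IsCompactOperator (D * Q - Q * D : BL2)) : D ∈ masaSet e 𝔄 := by
  rw [mem_masaSet_iff]
  refine ⟨hD, fun X => ?_⟩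
  have hQb := rotProj_mem_blockSet (e := e) (𝔄 X) ![(X : Set ℕ), ∅]
  have hQ : rotProj e (𝔄 X) ![(X : Set ℕ), ∅] ∈ masaSet e 𝔄 := by
    refine rotProj_mem_masaSet fun Y hY i => ?_
    fin_cases i
    · exact hcoh X Y hY.symm
    · simp
  have h1 := (isCompactOperator_iff_tendsto_blk
    (blockSet_sub (blockSet_mul hD hQb) (blockSet_mul hQb hD))).1 (h _ hQ)
  have h2 := (tendsto_conjRot (𝔄 X) h1).mono_left (inf_le_left (b := 𝓟 (X : Set ℕ)))
  have h3 : ∀ i j, i ≠ j → ∀ n ∈ (X : Set ℕ),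
      ‖conjRot (𝔄 X) (blk e (D * rotProj e (𝔄 X) ![(X : Set ℕ), ∅]
        - rotProj e (𝔄 X) ![(X : Set ℕ), ∅] * D) n) i j‖
      = ‖conjRot (𝔄 X) (blk e D n) i j‖ := by
    intro i j hij n hn
    rw [blk_sub, blk_mul hQb, blk_mul hD, conjRot_sub, conjRot_mul, conjRot_mul, blk_rotProj,
      conjRot_conjRot, Matrix.sub_apply, Matrix.mul_diagonal, Matrix.diagonal_mul]
    fin_cases i <;> fin_cases j <;> simp_all
  intro i j hij
  rw [tendsto_zero_iff_norm_tendsto_zero]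
  have h4 := (tendsto_entry h2 i j).norm
  rw [norm_zero] at h4
  refine h4.congr' ?_
  filter_upwards [mem_inf_of_right (mem_principal_self (X : Set ℕ))] with n hn
  exact h3 i j hij n hn

theorem mem_calkinMasa {𝒳 : Set (Set ℕ)} {𝔄 : 𝒳 → Param} {x : Calkin} :
    x ∈ calkinMasa e 𝔄 ↔ ∃ T ∈ masaSet e 𝔄, calkinMap T = x := StarSubalgebra.mem_map

theorem isMasa_calkinMasa {𝒳 : Set (Set ℕ)} {𝔄 : 𝒳 → Param}
    (hcoh : ∀ X Y : 𝒳, 𝔄 X ≠ 𝔄 Y → ((X : Set ℕ) ∩ Y).Finite)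
    (hdense : ∀ Z : Set ℕ, Z.Infinite → ∃ X ∈ 𝒳, (X ∩ Z).Infinite) :
    IsMasa (calkinMasa e 𝔄) := by
  constructor
  · intro x hx y hy
    obtain ⟨S, hS, rfl⟩ := mem_calkinMasa.1 hx
    obtain ⟨T, hT, rfl⟩ := mem_calkinMasa.1 hy
    exact calkinMap_commute_iff.2 (masaSet_commute hdense hS hT)
  · intro C hC hle x hx
    obtain ⟨T, rfl⟩ := calkinMap_surjective x
    have hcomm : ∀ Q ∈ masaSet e 𝔄, calkinMap Q * calkinMap T = calkinMap T * calkinMap Q :=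
      fun Q hQ => hC _ (hle (mem_calkinMasa.2 ⟨Q, hQ, rfl⟩)) _ hx
    obtain ⟨D, hD, hTD⟩ := exists_blockSet_sub_compact (e := e) (T := T) fun Y =>
      calkinMap_commute_iff.1 (hcomm _ (blockProj_mem_masaSet Y))
    rw [← calkinMap_eq_iff] at hTD
    refine mem_calkinMasa.2 ⟨D, mem_masaSet_of_commute hcoh hD fun Q hQ => ?_, hTD.symm⟩
    rw [← calkinMap_commute_iff, ← hTD]
    exact (hcomm Q hQ).symm

/-! ### Combinatorics of the families of sets -/

theorem h0_cyl_antitone (x : ℕ → Bool) : Antitone fun n => (h0 (cyl x n) : Set ℕ) :=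
  fun _ _ hmn _ hk i hi => hk i (hi.trans_le hmn)

/-- Sets converging to different points of the Cantor space are almost disjoint. -/
theorem finite_inter_of_ne {x y : ℕ → Bool} (hxy : x ≠ y) {X Y : Set ℕ}
    (hX : ∀ n, (X \ h0 (cyl x n)).Finite) (hY : ∀ n, (Y \ h0 (cyl y n)).Finite) :
    (X ∩ Y).Finite := by
  obtain ⟨i, hi⟩ := Function.ne_iff.1 hxy
  refine ((hX (i + 1)).union (hY (i + 1))).subset fun k hk => ?_
  by_cases h : k ∈ h0 (cyl x (i + 1))
  · refine Or.inr ⟨hk.2, fun h' => hi ?_⟩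
    rw [← h i (Nat.lt_succ_self i), h' i (Nat.lt_succ_self i)]
  · exact Or.inl ⟨hk.1, h⟩

theorem eq_of_mem_pointFamily {x y : ℕ → Bool} {X : Set ℕ} (hx : X ∈ pointFamily x)
    (hy : X ∈ pointFamily y) : x = y := by
  by_contra hxy
  have := finite_inter_of_ne hxy hx.2 hy.2
  rw [Set.inter_self] at this
  exact hx.1 this

/-- By compactness of the Cantor space, every infinite set contains a member of some
`pointFamily x`. -/
theorem exists_subset_mem_pointFamily {Z : Set ℕ} (hZ : Z.Infinite) :
    ∃ x, ∃ W ⊆ Z, W ∈ pointFamily x := by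
  let z := hZ.natEmbedding
  obtain ⟨x, φ, hφ, hlim⟩ := CompactSpace.tendsto_subseq fun k => divPattern (z k)
  have hinj : Function.Injective fun k => ((z (φ k) : Z) : ℕ) :=
    Subtype.val_injective.comp (z.injective.comp hφ.injective)
  refine ⟨x, Set.range fun k => ((z (φ k) : Z) : ℕ), ?_, Set.infinite_range_of_injective hinj, ?_⟩
  · rintro _ ⟨k, rfl⟩
    exact (z (φ k)).2
  · intro n
    have hmem : ∀ᶠ k in atTop, divPattern (z (φ k)) ∈ cyl x n :=
      hlim ((cyl x n).isClopen.isOpen.mem_nhds fun i _ => rfl)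
    rw [← Nat.cofinite_eq_atTop, eventually_cofinite] at hmem
    refine (hmem.image fun k => ((z (φ k) : Z) : ℕ)).subset ?_
    rintro _ ⟨⟨k, rfl⟩, hk⟩
    exact ⟨k, hk, rfl⟩

theorem IsInfiniteMAD.exists_infinite_inter {x : ℕ → Bool} {𝒴 : Set (Set ℕ)}
    (h : IsInfiniteMAD (pointFamily x) 𝒴) {Z : Set ℕ} (hZ : Z ∈ pointFamily x) :
    ∃ Y ∈ 𝒴, (Y ∩ Z).Infinite := by
  by_contra! hcon
  have hcon' : ∀ Y ∈ 𝒴, (Y ∩ Z).Finite := hcon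
  have hins : insert Z 𝒴 ⊆ 𝒴 := h.2.2 ⟨Set.insert_subset hZ h.2.1.1, by
    rw [Set.pairwise_insert]
    refine ⟨h.2.1.2, fun Y hY _ => ⟨?_, hcon' Y hY⟩⟩
    rw [Set.inter_comm]; exact hcon' Y hY⟩ (Set.subset_insert _ _)
  have := hcon' Z (hins (Set.mem_insert _ _))
  rw [Set.inter_self] at this
  exact hZ.1 this

variable {𝒴 : (ℕ → Bool) → Set (Set ℕ)} {a : Set (ℕ → Bool)}

theorem mem_unionFamily_iff {X : Set ℕ} :
    X ∈ unionFamily 𝒴 a ↔ (∃ x ∈ a, X ∈ pointFamily x) ∨ ∃ x ∉ a, X ∈ 𝒴 x := by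
  simp [unionFamily]

theorem mem_unionFamily_of_mem {x : ℕ → Bool} (hx : x ∈ a) {X : Set ℕ} (hX : X ∈ pointFamily x) :
    X ∈ unionFamily 𝒴 a := mem_unionFamily_iff.2 (Or.inl ⟨x, hx, hX⟩)

theorem mem_unionFamily_of_notMem {x : ℕ → Bool} (hx : x ∉ a) {X : Set ℕ} (hX : X ∈ 𝒴 x) :
    X ∈ unionFamily 𝒴 a := mem_unionFamily_iff.2 (Or.inr ⟨x, hx, hX⟩)

theorem exists_mem_pointFamily (h𝒴 : ∀ x, IsInfiniteMAD (pointFamily x) (𝒴 x)) {X : Set ℕ}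
    (hX : X ∈ unionFamily 𝒴 a) : ∃ x, X ∈ pointFamily x := by
  rcases mem_unionFamily_iff.1 hX with ⟨x, -, h⟩ | ⟨x, -, h⟩
  · exact ⟨x, h⟩
  · exact ⟨x, (h𝒴 x).2.1.1 h⟩

theorem unionFamily_dense (h𝒴 : ∀ x, IsInfiniteMAD (pointFamily x) (𝒴 x)) {Z : Set ℕ}
    (hZ : Z.Infinite) : ∃ X ∈ unionFamily 𝒴 a, (X ∩ Z).Infinite := by
  obtain ⟨x, W, hWZ, hW⟩ := exists_subset_mem_pointFamily hZ
  by_cases hx : x ∈ a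
  · exact ⟨W, mem_unionFamily_of_mem hx hW, by rw [Set.inter_eq_left.2 hWZ]; exact hW.1⟩
  · obtain ⟨Y, hY, hYW⟩ := (h𝒴 x).exists_infinite_inter hW
    exact ⟨Y, mem_unionFamily_of_notMem hx hY, hYW.mono (Set.inter_subset_inter_right _ hWZ)⟩

variable {𝔄 : unionFamily 𝒴 a → Param}

/-- For `x ∈ a` the members of `pointFamily x` share a parameter of their own. -/
theorem HasFibres.exists_param (h : HasFibres 𝒴 a 𝔄) {x : ℕ → Bool} (hx : x ∈ a) :
    ∃ α, ∀ X : unionFamily 𝒴 a, 𝔄 X = α ↔ (X : Set ℕ) ∈ pointFamily x := by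
  have hmem : pointFamily x ∈
      Set.range fun r : Param => ((↑) : unionFamily 𝒴 a → Set ℕ) '' (𝔄 ⁻¹' {r}) := by
    rw [h]; exact Or.inl ⟨x, hx, rfl⟩
  obtain ⟨α, hα⟩ := hmem
  refine ⟨α, fun X => ?_⟩
  rw [← hα]
  exact ⟨fun hX => ⟨X, hX, rfl⟩, fun ⟨X', hX', h'⟩ => Subtype.ext h' ▸ hX'⟩

/-- For `x ∉ a` the parameter of a member of `𝒴 x` belongs to no other set. -/
theorem HasFibres.eq_of_param_eq (h : HasFibres 𝒴 a 𝔄) {x : ℕ → Bool} (hx : x ∉ a)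
    {X Y : unionFamily 𝒴 a} (hY : (Y : Set ℕ) ∈ 𝒴 x) (hXY : 𝔄 X = 𝔄 Y) : X = Y := by
  have hmem : {(Y : Set ℕ)} ∈
      Set.range fun r : Param => ((↑) : unionFamily 𝒴 a → Set ℕ) '' (𝔄 ⁻¹' {r}) := by
    rw [h]; exact Or.inr ⟨Y, Set.mem_biUnion (show x ∈ aᶜ from hx) hY, rfl⟩
  obtain ⟨r, hr⟩ := hmem
  have hfib : ∀ Z : unionFamily 𝒴 a, 𝔄 Z = r ↔ Z = Y := by
    intro Z
    have hZY : Z = Y ↔ (Z : Set ℕ) ∈ ({(Y : Set ℕ)} : Set (Set ℕ)) := by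
      rw [Set.mem_singleton_iff, Subtype.coe_inj]
    rw [hZY, ← hr]
    exact ⟨fun hZ => ⟨Z, hZ, rfl⟩, fun ⟨Z', hZ', h'⟩ => Subtype.ext h' ▸ hZ'⟩
  rw [← hfib, hXY, hfib]

/-- Members of the family with different parameters are almost disjoint. -/
theorem HasFibres.finite_inter (h𝒴 : ∀ x, IsInfiniteMAD (pointFamily x) (𝒴 x))
    (h : HasFibres 𝒴 a 𝔄) (X Y : unionFamily 𝒴 a) (hXY : 𝔄 X ≠ 𝔄 Y) :
    ((X : Set ℕ) ∩ Y).Finite := by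
  obtain ⟨x, hx⟩ := exists_mem_pointFamily h𝒴 X.2
  obtain ⟨y, hy⟩ := exists_mem_pointFamily h𝒴 Y.2
  by_cases hxy : x = y
  · subst hxy
    by_cases hxa : x ∈ a
    · obtain ⟨α, hα⟩ := h.exists_param hxa
      exact absurd (((hα X).2 hx).trans ((hα Y).2 hy).symm) hXY
    · have hmem : ∀ Z : unionFamily 𝒴 a, (Z : Set ℕ) ∈ pointFamily x → (Z : Set ℕ) ∈ 𝒴 x := by
        intro Z hZ
        rcases mem_unionFamily_iff.1 Z.2 with ⟨z, hz, hZz⟩ | ⟨z, hz, hZz⟩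
        · rw [eq_of_mem_pointFamily hZ hZz] at hxa
          exact absurd hz hxa
        · rwa [eq_of_mem_pointFamily hZ ((h𝒴 z).2.1.1 hZz)]
      refine (h𝒴 x).2.1.2 (hmem X hx) (hmem Y hy) fun hne => hXY ?_
      rw [Subtype.ext hne]
  · exact finite_inter_of_ne hxy hx.2 hy.2

/-- Countably many sets can be separated modulo finite sets from countably many sets almost
disjoint from them. -/
theorem exists_almost_separating {A D : ℕ → Set ℕ} (h : ∀ i j, (A i ∩ D j).Finite) :
    ∃ E : Set ℕ, (∀ i, (A i \ E).Finite) ∧ ∀ j, (E ∩ D j).Finite := by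
  refine ⟨⋃ i, A i \ ⋃ j ∈ Set.Iic i, D j, fun i => ?_, fun j => ?_⟩
  · refine ((Set.finite_Iic i).biUnion fun j _ => h i j).subset fun n hn => ?_
    by_contra hcon
    simp only [Set.mem_iUnion, not_exists] at hcon
    refine hn.2 (Set.mem_iUnion.2 ⟨i, hn.1, fun hD => ?_⟩)
    simp only [Set.mem_iUnion] at hD
    obtain ⟨j, hj, hD⟩ := hD
    exact hcon j hj ⟨hn.1, hD⟩
  · refine ((Set.finite_Iio j).biUnion fun i _ => h i j).subset ?_
    rintro n ⟨hn, hD⟩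
    obtain ⟨i, hA, hn⟩ := Set.mem_iUnion.1 hn
    have hij : i < j := by
      by_contra! hji
      exact hn (Set.mem_biUnion (show j ∈ Set.Iic i from hji) hD)
    exact Set.mem_biUnion (show i ∈ Set.Iio j from hij) ⟨hA, hD⟩

/-! ### The separation property that recovers the index set -/

/-- Countable separation at the point `x` of the Cantor space: given two sequences of idempotents
of `A`, all lying below every `g (cyl x n)` and with vanishing products between the sequences,
some element of `A` acts as the identity on the first sequence and annihilates the second.
Here `g` stands for a copy in `A` of the algebra of clopen sets. -/
def SeparatesAt {A : Type*} [Mul A] [Zero A] (g : Clopens (ℕ → Bool) → A) (x : ℕ → Bool) : Prop :=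
  ∀ p q : ℕ → A, (∀ i, p i * p i = p i) → (∀ i, q i * q i = q i) →
    (∀ i n, p i * g (cyl x n) = p i) → (∀ i n, q i * g (cyl x n) = q i) →
    (∀ i j, p i * q j = 0) → ∃ s, ∀ i, s * p i = p i ∧ s * q i = 0

/-- The copy of the algebra of clopen sets in `calkinMasa e 𝔄`. -/
def clopenProj (e : HilbertBasis ℕ ℂ L2) {𝒳 : Set (Set ℕ)} (𝔄 : 𝒳 → Param)
    (U : Clopens (ℕ → Bool)) : calkinMasa e 𝔄 :=
  ⟨calkinMap (blockProj e (h0 U)), mem_calkinMasa.2 ⟨_, blockProj_mem_masaSet _, rfl⟩⟩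

theorem SeparatesAt.of_equiv {A B : Type*} [NonUnitalNonAssocSemiring A]
    [NonUnitalNonAssocSemiring B] {g : Clopens (ℕ → Bool) → A} {x : ℕ → Bool} (Φ : A ≃+* B)
    (h : SeparatesAt (fun U => Φ (g U)) x) : SeparatesAt g x := by
  intro p q hp hq hpg hqg hpq
  obtain ⟨s, hs⟩ := h (fun i => Φ (p i)) (fun i => Φ (q i))
    (fun i => by rw [← map_mul, hp]) (fun i => by rw [← map_mul, hq])
    (fun i n => by rw [← map_mul, hpg]) (fun i n => by rw [← map_mul, hqg])
    (fun i j => by rw [← map_mul, hpq, map_zero])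
  refine ⟨Φ.symm s, fun i => ⟨Φ.injective ?_, Φ.injective ?_⟩⟩
  · rw [map_mul, Φ.apply_symm_apply, (hs i).1]
  · rw [map_mul, Φ.apply_symm_apply, (hs i).2, map_zero]

theorem tendsto_blk_compl_of_mul_blockProj {S : BL2} (hS : S ∈ blockSet e) {H : Set ℕ}
    (h : calkinMap S * calkinMap (blockProj e H) = calkinMap S) :
    Tendsto (blk e S) (cofinite ⊓ 𝓟 Hᶜ) (𝓝 0) := by
  classical
  rw [← map_mul, calkinMap_eq_iff_tendsto (e := e) (blockSet_mul hS (blockSet_blockProj H)) hS] at h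
  have h1 := (h.mono_left (inf_le_left (b := 𝓟 Hᶜ))).neg
  rw [neg_zero] at h1
  refine h1.congr' ?_
  filter_upwards [mem_inf_of_right (mem_principal_self Hᶜ)] with n hn
  rw [blk_mul (blockSet_blockProj H), blk_blockProj, if_neg hn, mul_zero, zero_sub, neg_neg]

theorem eventually_norm_le_of_tendsto {l : Filter ℕ} {f : ℕ → ℂ} (h : Tendsto f l (𝓝 0)) {ε : ℝ} (hε : 0 < ε) :
    ∀ᶠ n in l, ‖f n‖ ≤ ε := by
  have := h.norm
  rw [norm_zero] at this
  exact (this.eventually (gt_mem_nhds hε)).mono fun n hn => hn.le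

/-- If all members of `pointFamily x` carry the parameter `α`, then an element concentrated at `x`
is asymptotically diagonal in the basis rotated by `α`. -/
theorem tendsto_offDiag {x : ℕ → Bool} (hx : x ∈ a) {α : Param}
    (hα : ∀ X : unionFamily 𝒴 a, 𝔄 X = α ↔ (X : Set ℕ) ∈ pointFamily x) {S : BL2}
    (hS : S ∈ masaSet e 𝔄)
    (h : ∀ n, calkinMap S * calkinMap (blockProj e (h0 (cyl x n))) = calkinMap S)
    {i j : Fin 2} (hij : i ≠ j) :
    Tendsto (fun n => conjRot α (blk e S n) i j) cofinite (𝓝 0) := by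
  rw [mem_masaSet_iff] at hS
  rw [tendsto_zero_iff_norm_tendsto_zero, Metric.tendsto_nhds]
  intro ε hε
  rw [eventually_cofinite]
  by_contra hinf
  -- otherwise the set of large entries belongs to `pointFamily x`
  have hZ : {n | ¬ dist ‖conjRot α (blk e S n) i j‖ 0 < ε} ∈ pointFamily x := by
    refine ⟨hinf, fun n => ?_⟩
    have h1 := tendsto_entry (tendsto_conjRot α (tendsto_blk_compl_of_mul_blockProj hS.1 (h n))) i j
    refine (finite_of_eventually (eventually_norm_le_of_tendsto h1 (half_pos hε))).subset fun k hk => ?_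
    refine ⟨hk.2, fun hle => hk.1 ?_⟩
    rw [Real.dist_0_eq_abs, abs_norm]
    exact lt_of_le_of_lt hle (half_lt_self hε)
  have h2 := hS.2 ⟨_, mem_unionFamily_of_mem hx hZ⟩ i j hij
  rw [(hα ⟨_, mem_unionFamily_of_mem hx hZ⟩).2 hZ] at h2
  refine hZ.1 ((finite_of_eventually (eventually_norm_le_of_tendsto h2 (half_pos hε))).subset fun k hk => ?_)
  refine ⟨hk, fun hle => hk ?_⟩
  rw [Real.dist_0_eq_abs, abs_norm]
  exact lt_of_le_of_lt hle (half_lt_self hε)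

/-- The approximate idempotency `c * c ≈ c` forces `c ≈ 0` once `‖c‖ ≤ 1 / 2`. -/
theorem norm_le_of_half_le {c : ℂ} (h : ‖c‖ ≤ 1 / 2) : ‖c‖ ≤ 2 * ‖c * c - c‖ := by
  have h1 : ‖c * c - c‖ = ‖c‖ * ‖c - 1‖ := by rw [← norm_mul]; congr 1; ring
  have h2 : 1 - ‖c‖ ≤ ‖c - 1‖ := by
    have := norm_sub_norm_le (1 : ℂ) c
    rwa [norm_one, norm_sub_rev] at this
  rw [h1]
  nlinarith [norm_nonneg c]

/-- The diagonal entries of a product are asymptotically the products of the diagonal entries if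
one factor is bounded and the other asymptotically diagonal. -/
theorem tendsto_mul_diag_sub {C D : ℕ → Matrix (Fin 2) (Fin 2) ℂ} {c : ℝ}
    (hC : ∀ n i j, ‖C n i j‖ ≤ c)
    (hD0 : ∀ i j, i ≠ j → Tendsto (fun n => D n i j) cofinite (𝓝 0)) (t : Fin 2) :
    Tendsto (fun n => (C n * D n) t t - C n t t * D n t t) cofinite (𝓝 0) := by
  have h : ∀ n, (C n * D n) t t - C n t t * D n t t = C n t (t + 1) * D n (t + 1) t := by
    intro n
    rw [Matrix.mul_apply, Fin.sum_univ_two]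
    fin_cases t <;> simp
  simp only [h]
  exact tendsto_zero_of_bounded_mul (fun n => hC n _ _) (hD0 _ _ (by fin_cases t <;> decide))

/-- At a point of `a` countable separation holds: elements concentrated at `x` are asymptotically
diagonal in one and the same rotated basis, and sequences of `0`-`1` diagonals can be separated
by a diagonal argument. -/
theorem separatesAt_of_mem (h𝒴 : ∀ x, IsInfiniteMAD (pointFamily x) (𝒴 x))
    (h𝔄 : HasFibres 𝒴 a 𝔄) {x : ℕ → Bool} (hx : x ∈ a) :
    SeparatesAt (clopenProj e 𝔄) x := by
  obtain ⟨α, hα⟩ := h𝔄.exists_param hx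
  intro p q hp hq hpg hqg hpq
  choose S hS hSp using fun i => mem_calkinMasa.1 (p i).2
  choose T hT hTq using fun i => mem_calkinMasa.1 (q i).2
  have hp' : ∀ i, calkinMap (S i) * calkinMap (S i) = calkinMap (S i) := fun i => by
    rw [hSp]; exact congrArg Subtype.val (hp i)
  have hq' : ∀ i, calkinMap (T i) * calkinMap (T i) = calkinMap (T i) := fun i => by
    rw [hTq]; exact congrArg Subtype.val (hq i)
  have hpg' : ∀ i n, calkinMap (S i) * calkinMap (blockProj e (h0 (cyl x n))) = calkinMap (S i) :=
    fun i n => by rw [hSp]; exact congrArg Subtype.val (hpg i n)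
  have hqg' : ∀ i n, calkinMap (T i) * calkinMap (blockProj e (h0 (cyl x n))) = calkinMap (T i) :=
    fun i n => by rw [hTq]; exact congrArg Subtype.val (hqg i n)
  have hpq' : ∀ i j, calkinMap (S i) * calkinMap (T j) = calkinMap 0 := fun i j => by
    rw [hSp, hTq, map_zero]; exact congrArg Subtype.val (hpq i j)
  have hSb : ∀ i, S i ∈ blockSet e := fun i => (hS i).1
  have hTb : ∀ i, T i ∈ blockSet e := fun i => (hT i).1
  have hz : (0 : BL2) ∈ blockSet e := by simpa using blockSet_algebraMap (e := e) 0
  have hoffS := fun i {k l : Fin 2} (hkl : k ≠ l) => tendsto_offDiag hx hα (hS i) (hpg' i) hkl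
  have hoffT := fun i {k l : Fin 2} (hkl : k ≠ l) => tendsto_offDiag hx hα (hT i) (hqg' i) hkl
  have hbd : ∀ (R : BL2) n k l, ‖conjRot α (blk e R n) k l‖ ≤ 4 * ‖R‖ := fun R n k l =>
    norm_conjRot_le α (norm_nonneg _) (norm_blk_le _ _) k l
  -- the diagonal entries are asymptotically idempotent
  have hidem : ∀ (R : BL2), R ∈ blockSet e → calkinMap R * calkinMap R = calkinMap R →
      (∀ k l, k ≠ l → Tendsto (fun n => conjRot α (blk e R n) k l) cofinite (𝓝 0)) → ∀ t,
      Tendsto (fun n => conjRot α (blk e R n) t t * conjRot α (blk e R n) t t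
        - conjRot α (blk e R n) t t) cofinite (𝓝 0) := by
    intro R hR hRR hoff t
    rw [← map_mul, calkinMap_eq_iff_tendsto (e := e) (blockSet_mul hR hR) hR] at hRR
    have h1 := tendsto_entry (tendsto_conjRot α hRR) t t
    have h2 := h1.sub (tendsto_mul_diag_sub (hbd R) hoff t)
    rw [sub_zero] at h2
    refine h2.congr fun n => ?_
    rw [blk_mul hR, conjRot_sub, conjRot_mul, Matrix.sub_apply]
    ring
  -- the blocks where the `t`-th diagonal entry is close to `1` rather than to `0`
  let A : Fin 2 → ℕ → Set ℕ := fun t i => {n | 1 / 2 < ‖conjRot α (blk e (S i) n) t t‖}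
  let B : Fin 2 → ℕ → Set ℕ := fun t i => {n | 1 / 2 < ‖conjRot α (blk e (T i) n) t t‖}
  have hAB : ∀ t i j, (A t i ∩ B t j).Finite := by
    intro t i j
    have h0 := hpq' i j
    rw [← map_mul, calkinMap_eq_iff_tendsto (e := e) (blockSet_mul (hSb i) (hTb j)) hz] at h0
    have h1 := tendsto_entry (tendsto_conjRot α h0) t t
    have h2 := h1.sub (tendsto_mul_diag_sub (hbd (S i)) (fun k l hkl => hoffT j hkl) t)
    rw [sub_zero] at h2
    have h3 := eventually_norm_le_of_tendsto h2 (show (0 : ℝ) < 1 / 4 by norm_num)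
    rw [eventually_cofinite] at h3
    refine h3.subset fun n hn hle => ?_
    have hb0 : blk e 0 n = 0 := by ext k l; simp [blk_apply]
    rw [blk_mul (hTb j), hb0, sub_zero, conjRot_mul, sub_sub_cancel, norm_mul] at hle
    have h4 : 1 / 2 < ‖conjRot α (blk e (S i) n) t t‖ := hn.1
    have h5 : 1 / 2 < ‖conjRot α (blk e (T j) n) t t‖ := hn.2
    nlinarith
  have hAH : ∀ t i j, (A t i ∩ (h0 (cyl x j) : Set ℕ)ᶜ).Finite := by
    intro t i j
    have h1 := tendsto_entry (tendsto_conjRot α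
      (tendsto_blk_compl_of_mul_blockProj (hSb i) (hpg' i j))) t t
    refine (finite_of_eventually (eventually_norm_le_of_tendsto h1 one_half_pos)).subset fun n hn => ?_
    exact ⟨hn.2, not_le.2 hn.1⟩
  choose E hAE hED using fun t => exists_almost_separating (A := A t)
    (D := fun j => B t j ∪ (h0 (cyl x j) : Set ℕ)ᶜ) fun i j => by
      rw [Set.inter_union_distrib_left]
      exact (hAB t i j).union (hAH t i j)
  have hs : rotProj e α E ∈ masaSet e 𝔄 := by
    refine rotProj_mem_masaSet fun X hX t => ?_
    obtain ⟨y, hy⟩ := exists_mem_pointFamily h𝒴 X.2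
    have hxy : x ≠ y := by
      rintro rfl
      exact hX ((hα X).2 hy)
    exact finite_inter_of_ne hxy (fun n => (hED t n).subset fun k hk => ⟨hk.1, Or.inr hk.2⟩) hy.2
  have hsb := hs.1
  have hconj : ∀ (R : BL2), R ∈ blockSet e → ∀ n k l,
      conjRot α (blk e (rotProj e α E * R) n) k l
        = (E k).indicator 1 n * conjRot α (blk e R n) k l := by
    intro R hR n k l
    rw [blk_mul hR, conjRot_mul, blk_rotProj, conjRot_conjRot, Matrix.diagonal_mul]
  have hind : ∀ k n, ‖(E k).indicator (1 : ℕ → ℂ) n‖ ≤ 1 := by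
    intro k n
    by_cases hn : n ∈ E k <;> simp [hn]
  refine ⟨⟨calkinMap (rotProj e α E), mem_calkinMasa.2 ⟨_, hs, rfl⟩⟩, fun i => ⟨?_, ?_⟩⟩
  · apply Subtype.ext
    change calkinMap (rotProj e α E) * (p i : Calkin) = p i
    rw [← hSp, ← map_mul, calkinMap_eq_iff_tendsto (e := e) (blockSet_mul hsb (hSb i)) (hSb i)]
    suffices h : Tendsto (fun n => conjRot α (blk e (rotProj e α E * S i) n - blk e (S i) n))
        cofinite (𝓝 0) by
      simpa only [conjRot_conjRot] using tendsto_conjRot α h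
    refine tendsto_matrix fun k l => ?_
    simp only [conjRot_sub, Matrix.sub_apply, hconj _ (hSb i)]
    by_cases hkl : k = l
    · subst hkl
      have h1 := (hidem (S i) (hSb i) (hp' i) (fun k l hkl => hoffS i hkl) k).norm.const_mul 2
      rw [norm_zero, mul_zero] at h1
      refine squeeze_zero_norm' ?_ h1
      filter_upwards [(hAE k i).compl_mem_cofinite] with n hn
      by_cases hnE : n ∈ E k
      · rw [Set.indicator_of_mem hnE, Pi.one_apply, one_mul, sub_self, norm_zero]
        positivity
      · rw [Set.indicator_of_notMem hnE, zero_mul, zero_sub, norm_neg]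
        exact norm_le_of_half_le (not_lt.1 fun hA => hn ⟨hA, hnE⟩)
    · have h1 := (tendsto_zero_of_bounded_mul (hind k) (hoffS i hkl)).sub (hoffS i hkl)
      rwa [sub_zero] at h1
  · apply Subtype.ext
    change calkinMap (rotProj e α E) * (q i : Calkin) = 0
    rw [← hTq, ← map_mul, ← map_zero calkinMap,
      calkinMap_eq_iff_tendsto (e := e) (blockSet_mul hsb (hTb i)) hz]
    suffices h : Tendsto (fun n => conjRot α (blk e (rotProj e α E * T i) n)) cofinite (𝓝 0) by
      have hb0 : ∀ n, blk e 0 n = 0 := fun n => by ext k l; simp [blk_apply]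
      simpa only [conjRot_conjRot, hb0, sub_zero] using tendsto_conjRot α h
    refine tendsto_matrix fun k l => ?_
    simp only [hconj _ (hTb i)]
    by_cases hkl : k = l
    · subst hkl
      have h1 := (hidem (T i) (hTb i) (hq' i) (fun k l hkl => hoffT i hkl) k).norm.const_mul 2
      rw [norm_zero, mul_zero] at h1
      refine squeeze_zero_norm' ?_ h1
      filter_upwards [(hED k i).compl_mem_cofinite] with n hn
      by_cases hnE : n ∈ E k
      · rw [Set.indicator_of_mem hnE, Pi.one_apply, one_mul]
        exact norm_le_of_half_le (not_lt.1 fun hB => hn ⟨hnE, Or.inl hB⟩)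
      · rw [Set.indicator_of_notMem hnE, zero_mul, norm_zero]
        positivity
    · exact tendsto_zero_of_bounded_mul (hind k) (hoffT i hkl)

/-! ### Failure of separation at the points outside the index set -/

/-- The projection onto the first vector of the basis rotated by `γ`, as a matrix in the
original basis. -/
def firstProj (γ : ℝ) : Matrix (Fin 2) (Fin 2) ℂ := conjRot γ (Matrix.diagonal ![1, 0])

theorem continuous_firstProj : Continuous firstProj := by
  unfold firstProj conjRot
  have : Continuous rotMat := by
    refine continuous_pi fun i => continuous_pi fun j => ?_
    fin_cases i <;> fin_cases j <;> simp [rotMat] <;> fun_prop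
  fun_prop

/-- The projection `firstProj β` is diagonal in the basis rotated by `γ` only if `γ = β`: the
rotation angles lie in an interval shorter than a right angle. -/
theorem eq_of_conjRot_firstProj {β γ : ℝ} (hβ : 71 / 72 ≤ β) (hβ1 : β ≤ 1) (hγ : 71 / 72 ≤ γ)
    (hγ1 : γ ≤ 1) (h : conjRot γ (firstProj β) 0 1 = 0) : γ = β := by
  have hs : √(1 - β ^ 2) ^ 2 = 1 - β ^ 2 := Real.sq_sqrt (by nlinarith)
  have ht : √(1 - γ ^ 2) ^ 2 = 1 - γ ^ 2 := Real.sq_sqrt (by nlinarith)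
  have hs0 := Real.sqrt_nonneg (1 - β ^ 2)
  have ht0 := Real.sqrt_nonneg (1 - γ ^ 2)
  have hdiag : (Matrix.diagonal ![1, 0] : Matrix (Fin 2) (Fin 2) ℂ) = !![1, 0; 0, 0] := by
    ext i j; fin_cases i <;> fin_cases j <;> rfl
  simp only [conjRot, firstProj, rotMat, hdiag] at h
  generalize √(1 - β ^ 2) = s at *
  generalize √(1 - γ ^ 2) = t at *
  have h' : (γ * β + t * s) * (t * β - γ * s) = 0 := by
    rw [← Complex.ofReal_inj]
    push_cast
    rw [← h]
    simp [Matrix.mul_apply, Fin.sum_univ_two]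
    ring
  have hpos : 0 < γ * β + t * s := by positivity
  have h1 : t * β = γ * s := by
    rcases mul_eq_zero.1 h' with h0 | h0
    · exact absurd h0 hpos.ne'
    · linarith
  have h2 : γ ^ 2 = β ^ 2 := by
    have : t ^ 2 * β ^ 2 = γ ^ 2 * s ^ 2 := by rw [← mul_pow, ← mul_pow, h1]
    rw [hs, ht] at this
    linarith
  exact (sq_eq_sq₀ (by linarith) (by linarith)).1 h2

/-- At a point outside `a` countable separation fails. A separating element would be close to
`firstProj` of the parameter of `Y i` along `Y i`, for each of infinitely many members `Y i` of
`𝒴 x`. Near an accumulation point `β` of these parameters one then finds a set in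
`pointFamily x`, disjoint from the member of `𝒴 x` with parameter `β` (if any), along which the
blocks tend to `firstProj β`; it meets some member of `𝒴 x`, whose parameter has to be `β`. -/
theorem not_separatesAt_of_notMem (h𝒴 : ∀ x, IsInfiniteMAD (pointFamily x) (𝒴 x))
    (h𝔄 : HasFibres 𝒴 a 𝔄) {x : ℕ → Bool} (hx : x ∉ a) :
    ¬ SeparatesAt (clopenProj e 𝔄) x := by
  intro hsep
  let ι := (h𝒴 x).1.natEmbedding
  have hmemY : ∀ i, (ι i : Set ℕ) ∈ 𝒴 x := fun i => (ι i).2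
  let Y : ℕ → unionFamily 𝒴 a := fun i => ⟨ι i, mem_unionFamily_of_notMem hx (hmemY i)⟩
  have hYinj : Function.Injective Y := fun i j hij =>
    ι.injective (Subtype.ext (congrArg (fun Z : unionFamily 𝒴 a => (Z : Set ℕ)) hij))
  have hYx : ∀ i, (Y i : Set ℕ) ∈ 𝒴 x := hmemY
  have hYpt : ∀ i, (Y i : Set ℕ) ∈ pointFamily x := fun i => (h𝒴 x).2.1.1 (hYx i)
  have hYdisj : ∀ i j, i ≠ j → ((Y i : Set ℕ) ∩ Y j).Finite := fun i j hij =>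
    (h𝒴 x).2.1.2 (hYx i) (hYx j) fun h => hij (hYinj (Subtype.ext h))
  let α : ℕ → Param := fun i => 𝔄 (Y i)
  have hαinj : Function.Injective α := fun i j hij => hYinj (h𝔄.eq_of_param_eq hx (hYx j) hij)
  -- the projections onto the first (`t = 0`) or second (`t = 1`) rotated vectors over `Y i`
  let Q : Fin 2 → ℕ → BL2 := fun t i => rotProj e (α i) fun s => if s = t then (Y i : Set ℕ) else ∅
  have hQb : ∀ t i, Q t i ∈ blockSet e := fun t i => rotProj_mem_blockSet _ _
  have hQ : ∀ t i, Q t i ∈ masaSet e 𝔄 := by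
    intro t i
    refine rotProj_mem_masaSet fun X hX s => ?_
    split_ifs
    · exact h𝔄.finite_inter h𝒴 (Y i) X hX.symm
    · simp
  have hQ0 : ∀ t i, ∀ n ∉ (Y i : Set ℕ), blk e (Q t i) n = 0 := by
    intro t i n hn
    refine blk_rotProj_eq_zero _ fun s => ?_
    split_ifs
    · exact hn
    · simp
  let P : Fin 2 → ℕ → calkinMasa e 𝔄 := fun t i =>
    ⟨calkinMap (Q t i), mem_calkinMasa.2 ⟨_, hQ t i, rfl⟩⟩
  have hidem : ∀ t i, P t i * P t i = P t i := by
    intro t i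
    apply Subtype.ext
    change calkinMap (Q t i) * calkinMap (Q t i) = calkinMap (Q t i)
    rw [← map_mul]
    congr 1
    simp only [Q]
    rw [rotProj_mul]
    simp
  have hbelow : ∀ t i n, P t i * clopenProj e 𝔄 (cyl x n) = P t i := by
    classical
    intro t i n
    apply Subtype.ext
    change calkinMap (Q t i) * calkinMap (blockProj e (h0 (cyl x n))) = calkinMap (Q t i)
    rw [← map_mul, calkinMap_eq_iff_tendsto (e := e)
      (blockSet_mul (hQb t i) (blockSet_blockProj _)) (hQb t i)]
    refine tendsto_const_nhds.congr' ?_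
    filter_upwards [((hYpt i).2 n).compl_mem_cofinite] with k hk
    rw [blk_mul (blockSet_blockProj _), blk_blockProj]
    split_ifs with hkn
    · rw [mul_one, sub_self]
    · rw [hQ0 t i k fun hkY => hk ⟨hkY, hkn⟩, zero_mul, sub_zero]
  have horth : ∀ i j, P 0 i * P 1 j = 0 := by
    intro i j
    apply Subtype.ext
    change calkinMap (Q 0 i) * calkinMap (Q 1 j) = 0
    have hz : (0 : BL2) ∈ blockSet e := by simpa using blockSet_algebraMap (e := e) 0
    have hb0 : ∀ n, blk e 0 n = 0 := fun n => by ext k l; simp [blk_apply]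
    rw [← map_mul, ← map_zero calkinMap, calkinMap_eq_iff_tendsto (e := e)
      (blockSet_mul (hQb 0 i) (hQb 1 j)) hz]
    refine tendsto_const_nhds.congr' ?_
    by_cases hij : i = j
    · subst hij
      refine Eventually.of_forall fun n => ?_
      simp only [Q]
      rw [rotProj_mul, hb0, sub_zero, blk_rotProj_eq_zero]
      intro s
      fin_cases s <;> simp
    · filter_upwards [(hYdisj i j hij).compl_mem_cofinite] with n hn
      rw [blk_mul (hQb 1 j), hb0, sub_zero]
      by_cases hnY : n ∈ (Y i : Set ℕ)
      · rw [hQ0 1 j n fun h => hn ⟨hnY, h⟩, mul_zero]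
      · rw [hQ0 0 i n hnY, zero_mul]
  obtain ⟨s, hs⟩ := hsep (P 0) (P 1) (hidem 0) (hidem 1) (hbelow 0) (hbelow 1) horth
  obtain ⟨T, hT, hTs⟩ := mem_calkinMasa.1 s.2
  have hTb := hT.1
  -- along `Y i` the blocks of a separating element tend to the first rotated projection
  have hlimY : ∀ i, Tendsto (fun n => blk e T n - firstProj (α i))
      (cofinite ⊓ 𝓟 (Y i : Set ℕ)) (𝓝 0) := by
    intro i
    have hz : (0 : BL2) ∈ blockSet e := by simpa using blockSet_algebraMap (e := e) 0
    have h1 : calkinMap (T * Q 0 i) = calkinMap (Q 0 i) := by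
      rw [map_mul, hTs]; exact congrArg Subtype.val (hs i).1
    have h2 : calkinMap (T * Q 1 i) = calkinMap 0 := by
      rw [map_mul, hTs, map_zero]; exact congrArg Subtype.val (hs i).2
    rw [calkinMap_eq_iff_tendsto (e := e) (blockSet_mul hTb (hQb _ i)) (hQb _ i)] at h1
    rw [calkinMap_eq_iff_tendsto (e := e) (blockSet_mul hTb (hQb _ i)) hz] at h2
    have h3 := (h1.add h2).mono_left (inf_le_left (b := 𝓟 (Y i : Set ℕ)))
    rw [add_zero] at h3
    refine h3.congr' ?_
    filter_upwards [mem_inf_of_right (mem_principal_self (Y i : Set ℕ))] with n hn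
    have hb0 : blk e 0 n = 0 := by ext k l; simp [blk_apply]
    have h4 : blk e (Q 0 i) n = firstProj (α i) := by
      simp only [Q]
      rw [blk_rotProj, firstProj]
      congr 2
      ext k
      fin_cases k <;> simp [hn]
    have h5 : blk e (Q 0 i) n + blk e (Q 1 i) n = 1 := by
      simp only [Q]
      rw [blk_rotProj, blk_rotProj, ← conjRot_add, Matrix.diagonal_add, ← conjRot_one (α i)]
      congr 1
      rw [← Matrix.diagonal_one]
      congr 1
      ext k
      fin_cases k <;> simp [hn]
    rw [blk_mul (hQb 0 i), blk_mul (hQb 1 i), hb0, sub_zero, sub_add_eq_add_sub, ← mul_add, h5,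
      mul_one, h4]
  obtain ⟨β, hβ, hacc⟩ := (Set.infinite_range_of_injective
    (Subtype.val_injective.comp hαinj)).exists_accPt_of_subset_isCompact
    (isCompact_Icc (a := (71 / 72 : ℝ)) (b := 1)) (by
      rintro _ ⟨i, rfl⟩
      exact ⟨(α i).2.1.le, (α i).2.2⟩)
  have hnear : ∀ k : ℕ, ∃ i, (α i : ℝ) ≠ β ∧ |(α i : ℝ) - β| < 1 / ((k : ℝ) + 1) := by
    intro k
    rw [accPt_iff_nhds] at hacc
    obtain ⟨_, ⟨hy, ⟨i, rfl⟩⟩, hne⟩ := hacc _ (Metric.ball_mem_nhds β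
      (Nat.one_div_pos_of_nat (n := k) (α := ℝ)))
    exact ⟨i, hne, by simpa [Real.dist_eq] using hy⟩
  choose i hiβ hi using hnear
  -- the member of `𝒴 x` with parameter `β`, or the empty set if there is none
  let D : Set ℕ := {n | ∃ X : unionFamily 𝒴 a, (X : Set ℕ) ∈ 𝒴 x ∧ (𝔄 X : ℝ) = β ∧ n ∈ (X : Set ℕ)}
  have hD : ∀ k, ((Y (i k) : Set ℕ) ∩ D).Finite := by
    intro k
    by_cases hex : ∃ X : unionFamily 𝒴 a, (X : Set ℕ) ∈ 𝒴 x ∧ (𝔄 X : ℝ) = β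
    · obtain ⟨X, hX, hXβ⟩ := hex
      have hne : (Y (i k) : Set ℕ) ≠ X := fun h => hiβ k (by
        rw [← hXβ, ← Subtype.ext h])
      refine ((h𝒴 x).2.1.2 (hYx (i k)) hX hne).subset fun n hn => ⟨hn.1, ?_⟩
      obtain ⟨X', hX', hX'β, hn'⟩ := hn.2
      rwa [← h𝔄.eq_of_param_eq hx hX (Subtype.ext (hX'β.trans hXβ.symm))]
    · refine Set.finite_empty.subset fun n hn => ?_
      obtain ⟨X, hX, hXβ, -⟩ := hn.2
      exact hex ⟨X, hX, hXβ⟩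
  have hpick : ∀ k : ℕ, ∃ n, k ≤ n ∧ n ∈ h0 (cyl x k) ∧ n ∉ D ∧
      ∀ r c, ‖(blk e T n - firstProj (α (i k))) r c‖ ≤ 1 / ((k : ℝ) + 1) := by
    intro k
    have h1 : ∀ᶠ n in cofinite ⊓ 𝓟 (Y (i k) : Set ℕ),
        ∀ r c, ‖(blk e T n - firstProj (α (i k))) r c‖ ≤ 1 / ((k : ℝ) + 1) := by
      rw [eventually_all]
      intro r
      rw [eventually_all]
      exact fun c => eventually_norm_le_of_tendsto (tendsto_entry (hlimY (i k)) r c)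
        Nat.one_div_pos_of_nat
    have hfin := (((finite_of_eventually h1).union (hD k)).union ((hYpt (i k)).2 k)).union
      (Set.finite_Iio k)
    obtain ⟨n, hnY, hn⟩ := (hYpt (i k)).1.exists_notMem_finite hfin
    simp only [Set.mem_union, not_or] at hn
    refine ⟨n, not_lt.1 hn.2, ?_, fun h => hn.1.1.2 ⟨hnY, h⟩, ?_⟩
    · by_contra h
      exact hn.1.2 ⟨hnY, h⟩
    · by_contra h
      exact hn.1.1.1 ⟨hnY, h⟩
  choose w hwk hwH hwD hwT using hpick
  have hwtop : Tendsto w atTop atTop := tendsto_atTop_mono hwk tendsto_id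
  have hW : Set.range w ∈ pointFamily x := by
    refine ⟨?_, fun n => ?_⟩
    · refine Set.infinite_of_forall_exists_gt fun k => ⟨w (k + 1), ⟨_, rfl⟩, ?_⟩
      exact lt_of_lt_of_le (Nat.lt_succ_self k) (hwk (k + 1))
    · refine ((Set.finite_Iio n).image w).subset ?_
      rintro _ ⟨⟨k, rfl⟩, hk⟩
      refine ⟨k, ?_, rfl⟩
      by_contra hnk
      exact hk (h0_cyl_antitone x (not_lt.1 hnk) (hwH k))
  obtain ⟨X, hX, hXW⟩ := (h𝒴 x).exists_infinite_inter hW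
  let X' : unionFamily 𝒴 a := ⟨X, mem_unionFamily_of_notMem hx hX⟩
  have hK : (w ⁻¹' X).Infinite := by
    intro hfin
    refine hXW ((hfin.image w).subset ?_)
    rintro _ ⟨hn, ⟨k, rfl⟩⟩
    exact ⟨k, hn, rfl⟩
  have hne : (cofinite ⊓ 𝓟 (w ⁻¹' X)).NeBot := cofinite_inf_principal_neBot_iff.2 hK
  have hle : cofinite ⊓ 𝓟 (w ⁻¹' X) ≤ (atTop : Filter ℕ) :=
    inf_le_left.trans Nat.cofinite_eq_atTop.le
  have hαlim : Tendsto (fun k => (α (i k) : ℝ)) atTop (𝓝 β) := by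
    rw [tendsto_iff_norm_sub_tendsto_zero]
    exact squeeze_zero (fun _ => norm_nonneg _) (fun k => (hi k).le)
      tendsto_one_div_add_atTop_nhds_zero_nat
  have hTlim : Tendsto (fun k => blk e T (w k)) atTop (𝓝 (firstProj β)) := by
    have h1 : Tendsto (fun k => blk e T (w k) - firstProj (α (i k))) atTop (𝓝 0) :=
      tendsto_matrix fun r c => squeeze_zero_norm (fun k => hwT k r c)
        tendsto_one_div_add_atTop_nhds_zero_nat
    have h2 := h1.add ((continuous_firstProj.tendsto β).comp hαlim)
    rw [zero_add] at h2
    refine h2.congr fun k => ?_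
    rw [Function.comp_apply, sub_add_cancel]
  have h01 : (0 : Fin 2) ≠ 1 := by decide
  have hd := (mem_masaSet_iff.1 hT).2 X' 0 1 h01
  have hcomp : Tendsto w (cofinite ⊓ 𝓟 (w ⁻¹' X)) (cofinite ⊓ 𝓟 X) := by
    refine tendsto_inf.2 ⟨?_, ?_⟩
    · rw [Nat.cofinite_eq_atTop]
      exact hwtop.mono_left inf_le_left
    · exact tendsto_principal.2 (mem_inf_of_right (mem_principal_self _))
  have h1 := hd.comp hcomp
  have h2 : Tendsto (fun k => conjRot (𝔄 X') (blk e T (w k)) 0 1) (cofinite ⊓ 𝓟 (w ⁻¹' X))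
      (𝓝 (conjRot (𝔄 X') (firstProj β) 0 1)) :=
    tendsto_pi_nhds.1 (tendsto_pi_nhds.1
      (((continuous_conjRot _).tendsto _).comp (hTlim.mono_left hle)) 0) 1
  have h3 := tendsto_nhds_unique h2 h1
  have h4 := eq_of_conjRot_firstProj hβ.1 hβ.2 (𝔄 X').2.1.le (𝔄 X').2.2 h3
  obtain ⟨k, hk⟩ := hK.nonempty
  exact hwD k ⟨X', hX, h4, hk⟩

/-! ### Counting isomorphism classes -/

open Cardinal

theorem mk_BL2_le : #BL2 ≤ 𝔠 := by
  let e : HilbertBasis ℕ ℂ L2 := HilbertBasis.ofRepr (LinearIsometryEquiv.refl ℂ L2)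
  have hinj : Function.Injective fun (T : BL2) (p : ℕ × ℕ) => (inner ℂ (e p.1) (T (e p.2)) : ℂ) :=
    fun S T h => op_ext (e := e) fun k => eq_of_inner_basis (e := e) fun m => congrFun h (m, k)
  refine (mk_le_of_injective hinj).trans ?_
  simp

theorem mk_calkin_le : #Calkin ≤ 𝔠 := (mk_le_of_surjective calkinMap_surjective).trans mk_BL2_le

theorem mk_clopens_le : #(Clopens (ℕ → Bool)) ≤ ℵ₀ := by
  have : Countable (Clopens (ℕ → Bool)) :=
    TopologicalSpace.Clopens.countable_iff_secondCountable.2 inferInstance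
  exact mk_le_aleph0

theorem mk_clopens_fun_le (A : StarSubalgebra ℂ Calkin) : #(Clopens (ℕ → Bool) → A) ≤ 𝔠 := by
  have h1 : #A ≤ 𝔠 := (mk_subtype_le _).trans mk_calkin_le
  have h2 : #(Clopens (ℕ → Bool) → A) = #A ^ #(Clopens (ℕ → Bool)) := by simp
  rw [h2]
  calc #A ^ #(Clopens (ℕ → Bool)) ≤ 𝔠 ^ #(Clopens (ℕ → Bool)) := power_le_power_right h1
    _ ≤ 𝔠 ^ ℵ₀ := power_le_power_left continuum_ne_zero mk_clopens_le
    _ = 𝔠 := continuum_power_aleph0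

/-- An equivalence relation with classes of size at most continuum on a set of size `2 ^ 𝔠` has
`2 ^ 𝔠` classes. -/
theorem exists_pairwise_not_rel {α : Type} (r : Setoid α) (hα : #α = 2 ^ 𝔠)
    (hr : ∀ b, #{a | r a b} ≤ 𝔠) : ∃ s : Set α, #s = 2 ^ 𝔠 ∧ s.Pairwise fun a b => ¬ r a b := by
  refine ⟨Set.range (Quotient.out : Quotient r → α), ?_, ?_⟩
  · refine le_antisymm ((mk_set_le _).trans hα.le) ?_
    rw [mk_range_eq _ Quotient.out_injective]
    by_contra! hlt
    have h1 : #α ≤ #(Quotient r) * 𝔠 := by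
      refine mk_le_mk_mul_of_mk_preimage_le (Quotient.mk r) fun q => ?_
      obtain ⟨b, rfl⟩ := Quotient.exists_rep q
      refine le_trans (mk_le_mk_of_subset fun a ha => ?_) (hr b)
      exact Quotient.exact ha
    have h2 : #(Quotient r) * 𝔠 < 2 ^ 𝔠 :=
      mul_lt_of_lt (aleph0_le_continuum.trans (cantor 𝔠).le) hlt (cantor 𝔠)
    exact absurd (hα ▸ h1) (not_le.2 h2)
  · rintro _ ⟨p, rfl⟩ _ ⟨q, rfl⟩ hpq hr
    exact hpq (congrArg Quotient.out (Quotient.out_equiv_out.1 hr))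

/-- Each algebra is isomorphic to at most continuum many others: an isomorphism recovers the
index set from the image of the countable algebra of clopen sets. -/
theorem mk_isomorphic_le (h𝒴 : ∀ x, IsInfiniteMAD (pointFamily x) (𝒴 x))
    (𝔄 : ∀ a : Set (ℕ → Bool), unionFamily 𝒴 a → Param) (h𝔄 : ∀ a, HasFibres 𝒴 a (𝔄 a))
    (b : Set (ℕ → Bool)) :
    #{a | Nonempty (calkinMasa e (𝔄 a) ≃⋆ₐ[ℂ] calkinMasa e (𝔄 b))} ≤ 𝔠 := by
  refine le_trans ?_ (mk_clopens_fun_le (calkinMasa e (𝔄 b)))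
  let Φ (a : {a | Nonempty (calkinMasa e (𝔄 a) ≃⋆ₐ[ℂ] calkinMasa e (𝔄 b))}) :
      calkinMasa e (𝔄 a.1) ≃⋆ₐ[ℂ] calkinMasa e (𝔄 b) := Classical.choice a.2
  let g := fun (a : {a | Nonempty (calkinMasa e (𝔄 a) ≃⋆ₐ[ℂ] calkinMasa e (𝔄 b))})
    (U : Clopens (ℕ → Bool)) => Φ a (clopenProj e (𝔄 a) U)
  have hg : ∀ a x, SeparatesAt (g a) x ↔ x ∈ a.1 := by
    intro a x
    constructor
    · intro h
      by_contra hx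
      exact not_separatesAt_of_notMem h𝒴 (h𝔄 a.1) hx
        (SeparatesAt.of_equiv (Φ a).toRingEquiv h)
    · intro hx
      refine SeparatesAt.of_equiv (Φ a).symm.toRingEquiv ?_
      have h := separatesAt_of_mem (e := e) h𝒴 (h𝔄 a.1) hx
      have hg' : (fun U => (Φ a).symm.toRingEquiv (g a U)) = clopenProj e (𝔄 a.1) :=
        funext fun U => (Φ a).symm_apply_apply _
      rwa [hg']
  refine mk_le_of_injective (f := g) fun a a' h => Subtype.ext (Set.ext fun x => ?_)
  rw [← hg, ← hg, h]

end

end CalkinMasa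

open CalkinMasa in
theorem proposition4p27
    (e : HilbertBasis ℕ ℂ L2)
    (𝒴 : (ℕ → Bool) → Set (Set ℕ))
    (h𝒴 : ∀ x, IsInfiniteMAD (pointFamily x) (𝒴 x))
    (𝔄 : ∀ a : Set (ℕ → Bool), unionFamily 𝒴 a → Param)
    (h𝔄 : ∀ a, HasFibres 𝒴 a (𝔄 a)) :
    (∀ a, IsMasa (calkinMasa e (𝔄 a))) ∧
    ∃ 𝒮 : Set (Set (ℕ → Bool)),
      Cardinal.mk 𝒮 = 2 ^ Cardinal.continuum ∧
      𝒮.Pairwise fun a b => IsEmpty (calkinMasa e (𝔄 a) ≃⋆ₐ[ℂ] calkinMasa e (𝔄 b)) := by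
  refine ⟨fun a => isMasa_calkinMasa ((h𝔄 a).finite_inter h𝒴) fun Z hZ =>
    unionFamily_dense h𝒴 hZ, ?_⟩
  let r : Setoid (Set (ℕ → Bool)) :=
    { r := fun a b => Nonempty (calkinMasa e (𝔄 a) ≃⋆ₐ[ℂ] calkinMasa e (𝔄 b))
      iseqv := ⟨fun a => ⟨StarAlgEquiv.refl ℂ _⟩, fun ⟨Φ⟩ => ⟨Φ.symm⟩, fun ⟨Φ⟩ ⟨Ψ⟩ => ⟨Φ.trans Ψ⟩⟩ }
  obtain ⟨𝒮, hcard, h𝒮⟩ := exists_pairwise_not_rel r (by simp)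
    fun b => mk_isomorphic_le (e := e) h𝒴 𝔄 h𝔄 b
  exact ⟨𝒮, hcard, h𝒮.mono' fun a b h => not_nonempty_iff.1 h⟩
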